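/- **Setting.** Let $n\ge 3$, let $\hat S_n$ be the affine symmetric group with Coxeter generators $s_i$, $i\in\mathbb Z/n$, let $\rho(s_i)=s_{i+1}$, and let $\phi:\hat S_n\to S_n$ send $s_i$ to the transposition $(i\ \,i+1)$ of residues mod $n$. A glide of offset $k\in\mathbb Z/n$ is an element $g$ with $\phi(g)(p)=p+k$ for all $p$. Fix words $u=s_{i_1}\cdots s_{i_l}$ with $l\ge1$ (state word) and $v=s_{j_1}\cdots s_{j_m}$ (carrier word) representing glides of offsets $k_1,k_2$, such that the concatenation $vu$ is reduced. A word is drawn, from left to right, as a wiring diagram on a cylinder, $s_i$ being a crossing of the wires in positions $i,i+1$ (positions are numbered from bottom to top, mod $n$); the upper wire of a crossing is the one that passes from top to bottom. Number the wires in the diagram of $v|u$ by their positions at the cut between $v$ and $u$, and fix wire weights $\alpha_1,\dots,\alpha_n\in\mathbb R$ such that $\alpha_i<\alpha_j$ whenever wires $i,j$ cross in this diagram with $j$ the upper wire. For $\mathbf z\in\mathbb R_{>0}^m$ and $\mathbf y\in\mathbb R_{>0}^l$ write $F(\mathbf z,\mathbf y)=(\mathbf y',\mathbf z')$ if the weighted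 word $s_{j_1}(z_1)\cdots s_{j_m}(z_m)\,s_{i_1}(y_1)\cdots s_{i_l}(y_l)$ can be transformed into $s_{i_1+k_2}(y_1')\cdots s_{i_l+k_2}(y'_l)\,s_{j_1-k_1}(z_1')\cdots s_{j_m-k_1}(z_m')$ by Lusztig's relations $$s_i(a)s_j(b)s_i(c)=s_j\!\left(\tfrac{bc}{a+c}\right)s_i(a+c)\,s_j\!\left(\tfrac{ab}{a+c}\right)\ (i-j\equiv\pm1),\qquad s_i(a)s_j(b)=s_j(b)s_i(a)\ (i-j\not\equiv0,\pm1).$$ Let the vacuum $\mathbf w$ and the initial carrier $\mathbf z_{-\infty}$ consist of the numbers $\beta-\alpha$ at the crossings of $u$ and of $v$ in $v|u$, where $\beta$ and $\alpha$ are the weights of the upper and lower wire. A solution of affine dKdV consists of states $\mathbf y_i^t\in\mathbb R_{>0}^l$ and carriers $\mathbf z_i^t\in\mathbb R_{>0}^m$ ($i,t\in\mathbb Z$) such that, for every $t$, $\lim_{i\to\pm\infty}\mathbf y_i^t=\mathbf w$, $\lim_{i\to-\infty}\mathbf z_i^t=\mathbf z_{-\infty}$, and $F(\mathbf z_i^t,\mathbf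 y_i^t)=(\mathbf y_i^{t+1},\mathbf z_{i+1}^t)$ for all $i$. Represent the states at time $t$ by the infinite word whose $i$-th block is $\rho^{-ik_1+tk_2}(u)$. The carrier $\mathbf z^t_i$ sits on a copy $\rho^{-ik_1+tk_2}(v)$ of $v$ that is inserted just to the left of this block and is then pushed through it. In the universal cover (the periodic diagram in the plane, with positions and wires indexed by $\mathbb Z$) number the wires by their positions just to the left of block $0$ at time $0$, and keep the numbers through all moves, so that all wires keep their labels along the diagrams at all times; wire $j\in\mathbb Z$ has weight $\alpha_{j\bmod n}$. A chamber with set $S\subset\mathbb Z$ of wires below it has the label $[S]=(\mathfrak s_1,\dots,\mathfrak s_n)\in\mathbb Z^n$, $\mathfrak s_i=\lceil\max\{b\in S: b\equiv i\bmod n\}/n\rceil$. A function $\tau:\mathbb Z^n\to\mathbb R$ is a BHZ datum if for all $s\in\mathbb Z^n$ and all distinct $i,j,k$ $$(\alpha_i-\alpha_j)\tau_{s+e_k}\tau_{s+e_i+e_j}+(\alpha_j-\alpha_k)\tau_{s+e_i}\tau_{s+e_j+e_k}+(\alpha_k-\alpha_i)\tau_{s+e_j}\tau_{s+e_i+e_k}=0,$$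 and a cylindric BHZ datum if moreover $\tau_{s+e_1+\cdots+e_n}=\tau_s$ for all $s$. For real $A_i,b_i,c_i$ ($1\le i\le N$) put $$\tau_s=\sum_{T\subseteq[N]}\ \prod_{i<j,\ i,j\in T}Z_{i,j}\ \prod_{i\in T}f_i,\qquad Z_{i,j}=\frac{(b_i-b_j)(c_i-c_j)}{(b_i-c_j)(c_i-b_j)},\qquad f_i=A_i\prod_{j=1}^n B_{i,j}^{\mathfrak s_j},\quad B_{i,j}=\frac{b_i-\alpha_j}{c_i-\alpha_j},$$ where $s=(\mathfrak s_1,\dots,\mathfrak s_n)$. **Theorem 1.2.** 1. All entries of $\mathbf w$ and $\mathbf z_{-\infty}$ are positive, and $F(\mathbf z_{-\infty},\mathbf w)=(\mathbf w,\mathbf z_{-\infty})$. 2. Let $b_i,c_i\notin\{\alpha_1,\dots,\alpha_n\}$ for all $i$, and $b_i\ne c_j$ for $i\neq j$. Then $\tau$ is a BHZ datum, and it is a cylindric BHZ datum if $\prod_j(b_i-\alpha_j)=\prod_j(c_i-\alpha_j)$ for all $i$. 3. Suppose in addition to all the conditions in 2 (including the product condition) that $A_i>0$, $B_{i,j}>0$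 for all $i,j$, that $b_i\ne c_i$ for all $i$, and that $b_i\neq b_j$ for $i\ne j$. Then $\tau_s>0$ for all $s\in\mathbb Z^n$, and the numbers $$a=(\alpha_i-\alpha_j)\frac{\tau_{[S]}\,\tau_{[S]+e_i+e_j}}{\tau_{[S]+e_i}\,\tau_{[S]+e_j}}$$ at the crossings of the copies of $u$ and $v$ ($i$ and $j$ being the labels mod $n$ of the upper and the lower wire of the crossing, and $S$ the chamber directly below it) form a solution $(\mathbf y_i^t,\mathbf z_i^t)$ of affine dKdV. 4. For every $N\ge1$ there are $b_1,\dots,b_N,c_1,\dots,c_N$ that satisfy the conditions in 3 (with arbitrary $A_i>0$). In particular, $N$-soliton solutions of affine dKdV exist for every $N\geq 1$. -/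

import Mathlib

open Filter Topology

instance neZeroOfThreeLe (n : ℕ) [h : Fact (3 ≤ n)] : NeZero n :=
  ⟨by have := h.out; omega⟩

theorem zmodOneNeZero (n : ℕ) [h : Fact (3 ≤ n)] : (1 : ZMod n) ≠ 0 := by
  have : Fact (1 < n) := ⟨by have := h.out; omega⟩
  exact one_ne_zero

/-! ## The affine symmetric group -/

/-- The Coxeter matrix of the affine symmetric group on `s_0, …, s_{n-1}` (`n ≥ 3`), indices mod
`n`: neighbouring generators satisfy the braid relation, the other distinct pairs commute. -/
def affineA (n : ℕ) [Fact (3 ≤ n)] : CoxeterMatrix (ZMod n) where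
  M := Matrix.of fun i j => if i = j then 1 else if i - j = 1 ∨ j - i = 1 then 3 else 2
  isSymm := by
    ext i j
    simp [Matrix.transpose_apply, eq_comm, or_comm]
  diagonal i := by simp
  off_diagonal i j h := by
    simp only [Matrix.of_apply, if_neg h]
    split_ifs <;> decide

/-- The word `s_{i_1} ⋯ s_{i_l}` (recorded as the list of its indices) is a reduced word in the
affine symmetric group. -/
def IsReducedWord {n : ℕ} [Fact (3 ≤ n)] (ω : List (ZMod n)) : Prop :=
  (affineA n).toCoxeterSystem.IsReduced ω

/-- The image of the word under the homomorphism `φ` to the symmetric group of the residues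
mod `n`, which sends `s_i` to the transposition `(i  i+1)`. -/
def finPerm {n : ℕ} (ω : List (ZMod n)) : Equiv.Perm (ZMod n) :=
  (ω.map fun i => Equiv.swap i (i + 1)).prod

/-- The offset `k` of a glide: `φ(g)` is then the cyclic shift `p ↦ p + k`. -/
def offset {n : ℕ} (ω : List (ZMod n)) : ZMod n := finPerm ω 0

/-- The word represents a glide: `φ` maps it to a cyclic shift. -/
def IsGlide {n : ℕ} (ω : List (ZMod n)) : Prop :=
  ∀ p : ZMod n, finPerm ω p = p + offset ω

/-- The rotation `ρ^k`, which replaces every `s_i` by `s_{i+k}`. -/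
def rot {n : ℕ} (k : ZMod n) (ω : List (ZMod n)) : List (ZMod n) := ω.map (· + k)

/-- The action of `s_i` on `ℤ`. -/
def simpleFun {n : ℕ} (i : ZMod n) (a : ℤ) : ℤ :=
  if (a : ZMod n) = i then a + 1 else if (a : ZMod n) = i + 1 then a - 1 else a

theorem simpleFun_involutive {n : ℕ} [Fact (3 ≤ n)] (i : ZMod n) :
    Function.Involutive (simpleFun i) := by
  intro a
  have h1 := zmodOneNeZero n
  unfold simpleFun
  by_cases h : (a : ZMod n) = i
  · simp [h, h1]
  · by_cases h' : (a : ZMod n) = i + 1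
    · simp [h', h1]
    · simp [h, h']

/-- The permutation of `ℤ` by which `s_i` acts. -/
def simplePerm {n : ℕ} [Fact (3 ≤ n)] (i : ZMod n) : Equiv.Perm ℤ :=
  (simpleFun_involutive i).toPerm

/-- The permutation of `ℤ` by which a word acts. -/
def wordPerm {n : ℕ} [Fact (3 ≤ n)] (ω : List (ZMod n)) : Equiv.Perm ℤ :=
  (ω.map simplePerm).prod

/-! ## Weighted words and the interaction of a carrier with a state -/

/-- The weighted word `s_{i_1}(y_1) ⋯ s_{i_l}(y_l)`, all indices being shifted by `k`. -/
def weighted {n : ℕ} (k : ZMod n) (ω : List (ZMod n)) (y : Fin ω.length → ℝ) :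
    List (ZMod n × ℝ) :=
  List.ofFn fun p => (ω.get p + k, y p)

/-- One application of Lusztig's relations inside a weighted word (with positive weights in the
braid relation). -/
inductive LusztigMove {n : ℕ} : List (ZMod n × ℝ) → List (ZMod n × ℝ) → Prop
  | braid (L R : List (ZMod n × ℝ)) (i j : ZMod n) (a b c : ℝ)
      (hij : i - j = 1 ∨ j - i = 1) (ha : 0 < a) (hb : 0 < b) (hc : 0 < c) :
      LusztigMove (L ++ [(i, a), (j, b), (i, c)] ++ R)
        (L ++ [(j, b * c / (a + c)), (i, a + c), (j, a * b / (a + c))] ++ R)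
  | comm (L R : List (ZMod n × ℝ)) (i j : ZMod n) (a b : ℝ)
      (h0 : i ≠ j) (h1 : i - j ≠ 1) (h2 : j - i ≠ 1) :
      LusztigMove (L ++ [(i, a), (j, b)] ++ R) (L ++ [(j, b), (i, a)] ++ R)

/-- `Interacts u v z y y' z'` says `F_{v,u}(z, y) = (y', z')`: Lusztig's relations transform the
weighted word `v(z) u(y)` into `ρ^{k₂}(u)(y') ρ^{-k₁}(v)(z')`, where `k₁`, `k₂` are the offsets
of `u` and `v`. -/
def Interacts {n : ℕ} (u v : List (ZMod n)) (z : Fin v.length → ℝ) (y : Fin u.length → ℝ)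
    (y' : Fin u.length → ℝ) (z' : Fin v.length → ℝ) : Prop :=
  Relation.ReflTransGen LusztigMove
    (weighted 0 v z ++ weighted 0 u y)
    (weighted (offset v) u y' ++ weighted (-offset u) v z')

/-! ## Wiring diagrams

A word is drawn from left to right, positions being numbered from bottom to top in the universal
cover of the cylinder.  A wiring `g` records that wire `g p` is in position `p`. -/

/-- The wiring just before letter number `p` of the word `ω`, if `g` is the wiring to the left of
`ω`. -/
def wiringAt {n : ℕ} [Fact (3 ≤ n)] (g : Equiv.Perm ℤ) (ω : List (ZMod n))
    (p : Fin ω.length) : Equiv.Perm ℤ :=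
  g * wordPerm (ω.take p)

/-- A position `a` such that letter number `p` crosses the wires in positions `a` and `a + 1`
(the one with `0 ≤ a < n`; the others are its shifts by multiples of `n`). -/
def crossPos {n : ℕ} (ω : List (ZMod n)) (p : Fin ω.length) : ℤ := ((ω.get p).val : ℤ)

/-- The wire (mod `n`) that passes from bottom to top at letter number `p`. -/
def lowerWire {n : ℕ} [Fact (3 ≤ n)] (g : Equiv.Perm ℤ) (ω : List (ZMod n))
    (p : Fin ω.length) : ZMod n :=
  ((wiringAt g ω p (crossPos ω p) : ℤ) : ZMod n)

/-- The wire (mod `n`) that passes from top to bottom at letter number `p`. -/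
def upperWire {n : ℕ} [Fact (3 ≤ n)] (g : Equiv.Perm ℤ) (ω : List (ZMod n))
    (p : Fin ω.length) : ZMod n :=
  ((wiringAt g ω p (crossPos ω p + 1) : ℤ) : ZMod n)

/-- The set of wires below the chamber that lies directly under the crossing at letter `p`. -/
def chamberBelow {n : ℕ} [Fact (3 ≤ n)] (g : Equiv.Perm ℤ) (ω : List (ZMod n))
    (p : Fin ω.length) : Set ℤ :=
  wiringAt g ω p '' Set.Iic (crossPos ω p - 1)

/-- The lattice vector `[S]` of a chamber: its `i`-th entry is
`⌈max {b ∈ S | b ≡ i mod n} / n⌉`. -/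
noncomputable def latticeVec (n : ℕ) (S : Set ℤ) (i : ZMod n) : ℤ :=
  ⌈((sSup {b : ℤ | b ∈ S ∧ (b : ZMod n) = i} : ℤ) : ℚ) / (n : ℚ)⌉

/-- The basis vector `e_i`. -/
def stdVec {n : ℕ} (i : ZMod n) : ZMod n → ℤ := Pi.single i 1

/-- The crossing parameters `β - α` of the wire ansatz, `β` and `α` being the weights of the upper
and of the lower wire. -/
noncomputable def wireParam {n : ℕ} [Fact (3 ≤ n)] (α : ZMod n → ℝ) (g : Equiv.Perm ℤ)
    (ω : List (ZMod n)) (p : Fin ω.length) : ℝ :=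
  α (upperWire g ω p) - α (lowerWire g ω p)

/-- The crossing parameters obtained from a `τ`-function:
`(α_i - α_j) τ_S τ_{S+e_i+e_j} / (τ_{S+e_i} τ_{S+e_j})`, where `i` is the upper wire, `j` the lower
wire and `S` the chamber under the crossing. -/
noncomputable def tauParam {n : ℕ} [Fact (3 ≤ n)] (α : ZMod n → ℝ) (τ : (ZMod n → ℤ) → ℝ)
    (g : Equiv.Perm ℤ) (ω : List (ZMod n)) (p : Fin ω.length) : ℝ :=
  (α (upperWire g ω p) - α (lowerWire g ω p)) *
    (τ (latticeVec n (chamberBelow g ω p)) *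
      τ (latticeVec n (chamberBelow g ω p) + stdVec (upperWire g ω p) +
        stdVec (lowerWire g ω p))) /
    (τ (latticeVec n (chamberBelow g ω p) + stdVec (upperWire g ω p)) *
      τ (latticeVec n (chamberBelow g ω p) + stdVec (lowerWire g ω p)))

/-! ## Affine dKdV -/

/-- `i ◁ j` for the diagram of `v|u`: the wires are numbered by their positions at the cut between
`v` and `u`, and wires `i`, `j` cross somewhere in the diagram with `j` being the upper one. -/
def CrossesUnder {n : ℕ} [Fact (3 ≤ n)] (u v : List (ZMod n)) (i j : ZMod n) : Prop :=
  ∃ p : Fin (v ++ u).length,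
    lowerWire (wordPerm v)⁻¹ (v ++ u) p = i ∧ upperWire (wordPerm v)⁻¹ (v ++ u) p = j

/-- The parameters of affine dKdV: the state word `u`, the carrier word `v` and the wire
weights `α`. -/
structure AffineDKdV (n : ℕ) [Fact (3 ≤ n)] where
  u : List (ZMod n)
  v : List (ZMod n)
  α : ZMod n → ℝ
  u_glide : IsGlide u
  v_glide : IsGlide v
  vu_reduced : IsReducedWord (v ++ u)
  α_lt : ∀ i j, CrossesUnder u v i j → α i < α j

namespace AffineDKdV

variable {n : ℕ} [Fact (3 ≤ n)] (P : AffineDKdV n)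

/-- The space of states (weights for `u`). -/
abbrev State : Type := Fin P.u.length → ℝ

/-- The space of carriers (weights for `v`). -/
abbrev Carrier : Type := Fin P.v.length → ℝ

/-- The vacuum: the weights of `u` in `v|u` given by the wire ansatz. -/
noncomputable def vacuum : P.State := wireParam P.α 1 P.u

/-- The initial carrier: the weights of `v` in `v|u` given by the wire ansatz. -/
noncomputable def initialCarrier : P.Carrier := wireParam P.α (wordPerm P.v)⁻¹ P.v

/-- One step of the time evolution, `z i` being the carrier that meets the `i`-th state. -/
structure IsStep (y : ℤ → P.State) (z : ℤ → P.Carrier) (y' : ℤ → P.State) : Prop where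
  carrier_pos : ∀ i p, 0 < z i p
  carrier_init : Tendsto z atBot (𝓝 P.initialCarrier)
  interacts : ∀ i, Interacts P.u P.v (z i) (y i) (y' i) (z (i + 1))

/-- A solution of affine dKdV: `y t` is the state sequence at time `t`, and `z t` is the sequence
of carriers in the step from time `t` to time `t + 1`. -/
structure IsSolution (y : ℤ → ℤ → P.State) (z : ℤ → ℤ → P.Carrier) : Prop where
  state_pos : ∀ t i p, 0 < y t i p
  tendsto_left : ∀ t, Tendsto (y t) atBot (𝓝 P.vacuum)
  tendsto_right : ∀ t, Tendsto (y t) atTop (𝓝 P.vacuum)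
  step : ∀ t, P.IsStep (y t) (z t) (y (t + 1))

/-- The rotation by which the `i`-th copy of `u` at time `t`, and the copy of `v` about to meet it,
are rotated: `-i k₁ + t k₂`. -/
def rotation (t i : ℤ) : ZMod n := -(i : ZMod n) * offset P.u + (t : ZMod n) * offset P.v

/-- `W t i` is the wiring to the left of the `i`-th copy of `u` at time `t`.  The wires are numbered
by their positions to the left of the copy of `u` with index `0` at time `0`; crossing a copy
of `u` leads from index `i` to `i + 1`, and crossing the copy of `v` that is about to meet the
`i`-th copy of `u` leads from the wiring at time `t + 1` to the wiring at time `t`. -/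
structure IsWiring (W : ℤ → ℤ → Equiv.Perm ℤ) : Prop where
  base : W 0 0 = 1
  state : ∀ t i, W t (i + 1) = W t i * wordPerm (rot (P.rotation t i) P.u)
  carrier : ∀ t i, W t i = W (t + 1) i * wordPerm (rot (P.rotation t i) P.v)

/-- The states given by the ratios of `τ` at the crossings of the copies of `u`. -/
noncomputable def tauState (W : ℤ → ℤ → Equiv.Perm ℤ) (τ : (ZMod n → ℤ) → ℝ) (t i : ℤ) :
    P.State :=
  fun p => tauParam P.α τ (W t i) (rot (P.rotation t i) P.u) (Fin.cast (by simp [rot]) p)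

/-- The carriers given by the ratios of `τ` at the crossings of the copies of `v`. -/
noncomputable def tauCarrier (W : ℤ → ℤ → Equiv.Perm ℤ) (τ : (ZMod n → ℤ) → ℝ) (t i : ℤ) :
    P.Carrier :=
  fun p => tauParam P.α τ (W (t + 1) i) (rot (P.rotation t i) P.v) (Fin.cast (by simp [rot]) p)

end AffineDKdV

/-! ## Berenstein–Hirota–Zelevinsky data and the `N`-soliton `τ`-function -/

/-- Berenstein–Hirota–Zelevinsky datum. -/
def IsBHZ {n : ℕ} (α : ZMod n → ℝ) (τ : (ZMod n → ℤ) → ℝ) : Prop :=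
  ∀ (s : ZMod n → ℤ) (i j k : ZMod n), i ≠ j → j ≠ k → i ≠ k →
    (α i - α j) * τ (s + stdVec k) * τ (s + stdVec i + stdVec j) +
      (α j - α k) * τ (s + stdVec i) * τ (s + stdVec j + stdVec k) +
      (α k - α i) * τ (s + stdVec j) * τ (s + stdVec i + stdVec k) = 0

/-- Cylindric Berenstein–Hirota–Zelevinsky datum. -/
def IsCylindricBHZ {n : ℕ} (α : ZMod n → ℝ) (τ : (ZMod n → ℤ) → ℝ) : Prop :=
  IsBHZ α τ ∧ ∀ s : ZMod n → ℤ, τ (s + 1) = τ s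

/-- `f_i = A_i ∏_j ((b_i - α_j) / (c_i - α_j)) ^ {s_j}`. -/
noncomputable def solitonFactor {n : ℕ} [Fact (3 ≤ n)] (α : ZMod n → ℝ) (A b c : ℝ)
    (s : ZMod n → ℤ) : ℝ :=
  A * ∏ j : ZMod n, ((b - α j) / (c - α j)) ^ (s j)

/-- `Z_{i,j} = (b_i - b_j)(c_i - c_j) / ((b_i - c_j)(c_i - b_j))`. -/
noncomputable def solitonZ {N : ℕ} (b c : Fin N → ℝ) (i j : Fin N) : ℝ :=
  ((b i - b j) * (c i - c j)) / ((b i - c j) * (c i - b j))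

/-- The `N`-soliton `τ`-function `∑_{T ⊆ [N]} ∏_{i < j in T} Z_{i,j} ∏_{i ∈ T} f_i`. -/
noncomputable def solitonTau {n : ℕ} [Fact (3 ≤ n)] {N : ℕ} (α : ZMod n → ℝ)
    (A b c : Fin N → ℝ) (s : ZMod n → ℤ) : ℝ :=
  ∑ T : Finset (Fin N),
    (∏ q ∈ (T ×ˢ T).filter (fun q => q.1 < q.2), solitonZ b c q.1 q.2) *
      ∏ i ∈ T, solitonFactor α (A i) (b i) (c i) s

/-- The cylindricity condition `∏_j (b_i - α_j) = ∏_j (c_i - α_j)` for all `i`. -/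
def CylindricPairs {n : ℕ} [Fact (3 ≤ n)] {N : ℕ} (α : ZMod n → ℝ) (b c : Fin N → ℝ) : Prop :=
  ∀ i, ∏ j : ZMod n, (b i - α j) = ∏ j : ZMod n, (c i - α j)

/-- Pairs `(b_i, c_i)` for which no denominator in the `τ`-function vanishes. -/
structure AdmissiblePairs {n : ℕ} {N : ℕ} (α : ZMod n → ℝ) (b c : Fin N → ℝ) : Prop where
  b_ne : ∀ i j, b i ≠ α j
  c_ne : ∀ i j, c i ≠ α j
  b_ne_c : ∀ i j, i ≠ j → b i ≠ c j

/-- Admissible pairs of `N` distinct nontrivial solitons that satisfy the regularity condition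
`B_{i,j} = (b_i - α_j) / (c_i - α_j) > 0`, that is, `b_i` and `c_i` lie in the same component of
the complement of the `α_j`. -/
structure RegularPairs {n : ℕ} {N : ℕ} (α : ZMod n → ℝ) (b c : Fin N → ℝ) : Prop
    extends AdmissiblePairs α b c where
  ratio_pos : ∀ i j, 0 < (b i - α j) / (c i - α j)
  nontrivial : ∀ i, b i ≠ c i
  distinct : ∀ i j, i ≠ j → b i ≠ b j

/-!
The proof has a combinatorial, an algebraic and an analytic part.

*Combinatorics.*  Every word acts on `ℤ` by a periodic permutation, and a glide acts as a
translation `transl m : a ↦ a + n m_a` composed with a shift `a ↦ a + k`.  Translations commute,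
which gives the wiring in closed form (`AffineDKdV.wiring`) and shows that `v u` and
`ρ^{k₂}(u) ρ^{-k₁}(v)` act by the same permutation.  Since the weights `α` increase at each crossing
of `v|u`, no two wires cross twice (`isAscending_of_weights`); a form of Matsumoto's theorem for
such words (`braidEquiv_of_wordPerm_eq`) then connects the two words by braid moves.  It rests on an
exchange property, `exists_braidEquiv_concat`, which is an induction on the length of the word.

*Algebra.*  Rotating a word and translating its wires amounts to shifting the argument of `τ`
(`tauParam_rot`), so that only one interaction has to be studied.  There the three-term relation of
`τ` is what turns a braid move into Lusztig's relation (`BraidMove.lusztigMove`); the vacuum is the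
case `τ = 1`.  The three-term relation for the soliton `τ`-function (`solitonSum_bilinear`) is a
Plücker relation: for distinct nodes the soliton sum is, up to a factor, a sum over the choices of
`x_a ∈ {b_a, c_a}` of the Vandermonde product of `x` times weights of the `x_a`, and in a product of
two such sums with choices `x`, `y`, Lagrange's identity for `∏ (z - x_a)` at the nodes `y_a` and
three of the `α_j` gives the relation, because the terms of the nodes `y_a` cancel under
exchanging `x_a` with `y_a`.  The general case follows by continuity in `b` and `c`.

*Analysis.*  From block to block the factor `f_k` is multiplied by `G_k = ∏_j B_{k,j} ^ {μ_j}`,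
where `μ` is the translation of the state word.  As `μ` increases with `α`, and is not constant, `G_k ≠ 1`
(`sum_mul_log_ne`): subtracting from `μ` a constant that separates its values below and above the
component of `b_k`, `c_k` gives all terms of `log G_k` the same sign.  Hence a single term of `τ`
dominates at each end and the parameters tend to the wire ansatz.  Positivity of `Z_{i,j}` holds
because `∑ log |x - α_j|` is strictly concave on each component, so that the pairs `b_i, c_i` and
`b_j, c_j` do not separate each other (`cross_pos`).  Such pairs exist by the intermediate value
theorem between two consecutive weights.
-/

/-! ### Periodic permutations of the integers -/

/-- The permutations `W` of `ℤ` with `W (a + n) = W a + n`. -/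
def periodicPerms (n : ℕ) : Subgroup (Equiv.Perm ℤ) where
  carrier := {W | ∀ a, W (a + n) = W a + n}
  mul_mem' {V W} hV hW a := by
    rw [Equiv.Perm.mul_apply, hW, hV, Equiv.Perm.mul_apply]
  one_mem' _ := rfl
  inv_mem' {W} hW a := by
    rw [Equiv.Perm.inv_eq_iff_eq, hW, Equiv.Perm.coe_inv, Equiv.apply_symm_apply]

section Periodic

variable {n : ℕ} {W : Equiv.Perm ℤ}

theorem periodicPerms_add_mul (hW : W ∈ periodicPerms n) (a q : ℤ) :
    W (a + n * q) = W a + n * q := by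
  have hadd (a : ℤ) : W (a + n) = W a + n := hW a
  induction q with
  | zero => simp
  | succ q ih => rw [mul_add, mul_one, ← add_assoc, hadd, ih, add_assoc]
  | pred q ih =>
    have := hadd (a + n * (-q - 1))
    rw [show a + n * (-q - 1) + n = a + (n : ℤ) * (-q) by ring, ih] at this
    linear_combination -this

theorem exists_add_mul_of_cast_eq {a b : ℤ} (h : (a : ZMod n) = b) : ∃ q : ℤ, b = a + n * q := by
  obtain ⟨q, hq⟩ := (ZMod.intCast_eq_intCast_iff_dvd_sub a b n).1 h
  exact ⟨q, by linear_combination hq⟩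

/-- A periodic permutation of `ℤ` induces a map on residues. -/
theorem periodicPerms_cast_congr (hW : W ∈ periodicPerms n) {a b : ℤ} (h : (a : ZMod n) = b) :
    (W a : ZMod n) = (W b : ZMod n) := by
  obtain ⟨q, rfl⟩ := exists_add_mul_of_cast_eq h
  simp [periodicPerms_add_mul hW]

theorem periodicPerms_cast_inj (hW : W ∈ periodicPerms n) {a b : ℤ}
    (h : (W a : ZMod n) = (W b : ZMod n)) : (a : ZMod n) = b := by
  simpa using periodicPerms_cast_congr (inv_mem hW) h

/-- The order of the wires in two neighbouring positions depends only on the positions mod `n`. -/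
theorem periodicPerms_lt_congr (hW : W ∈ periodicPerms n) {a b : ℤ} (h : (a : ZMod n) = b) :
    W a < W (a + 1) ↔ W b < W (b + 1) := by
  obtain ⟨q, rfl⟩ := exists_add_mul_of_cast_eq h
  rw [show a + n * q + 1 = a + 1 + n * q by ring, periodicPerms_add_mul hW,
    periodicPerms_add_mul hW]
  simp

theorem addRight_mem_periodicPerms (k : ℤ) : Equiv.addRight k ∈ periodicPerms n := fun a => by
  simp; ring

theorem addRight_mul (k l : ℤ) :
    (Equiv.addRight k : Equiv.Perm ℤ) * Equiv.addRight l = Equiv.addRight (k + l) := by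
  ext a; simp; ring

theorem addRight_inv (k : ℤ) :
    (Equiv.addRight k : Equiv.Perm ℤ)⁻¹ = Equiv.addRight (-k) := by
  ext a; simp

/-- The translation `a ↦ a + n m_a` (the index of `m` being read mod `n`). -/
def transl {n : ℕ} (m : ZMod n → ℤ) : Equiv.Perm ℤ where
  toFun a := a + n * m a
  invFun a := a - n * m a
  left_inv a := by simp
  right_inv a := by simp

theorem transl_apply (m : ZMod n → ℤ) (a : ℤ) : transl m a = a + n * m a := rfl

theorem cast_transl (m : ZMod n → ℤ) (a : ℤ) : (transl m a : ZMod n) = a := by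
  simp [transl_apply]

theorem transl_mul (m m' : ZMod n → ℤ) : transl m * transl m' = transl (m + m') := by
  ext a
  simp only [Equiv.Perm.mul_apply, transl_apply (m := m), cast_transl]
  simp only [transl_apply, Pi.add_apply]
  ring

theorem transl_zero : transl (0 : ZMod n → ℤ) = 1 := by
  ext a; simp [transl_apply]

theorem transl_inv (m : ZMod n → ℤ) : (transl m)⁻¹ = transl (-m) := by
  rw [inv_eq_iff_mul_eq_one, transl_mul, add_neg_cancel, transl_zero]

theorem transl_mem_periodicPerms (m : ZMod n → ℤ) : transl m ∈ periodicPerms n := fun a => by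
  simp [transl_apply]; ring

theorem transl_mul_addRight (m : ZMod n → ℤ) (k : ℤ) :
    transl m * Equiv.addRight k =
      Equiv.addRight k * transl fun j : ZMod n => m (j + (k : ZMod n)) := by
  ext a
  simp [transl_apply]; ring

/-- A periodic permutation that shifts all residues by `k` is a translation followed by a shift. -/
theorem exists_eq_transl_mul_addRight [NeZero n] (hW : W ∈ periodicPerms n) (k : ℤ)
    (h : ∀ a : ℤ, (W a : ZMod n) = a + k) : ∃ m : ZMod n → ℤ, W = transl m * Equiv.addRight k := by
  have key : ∀ a : ℤ, ∃ q : ℤ, W (a - k) = a + n * q := fun a =>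
    exists_add_mul_of_cast_eq (by rw [h]; simp)
  choose q hq using key
  refine ⟨fun j => q (j.val : ℤ), ?_⟩
  ext a
  obtain ⟨e, he⟩ : ∃ e : ℤ, a + k = (((a + k : ℤ) : ZMod n).val : ℤ) + n * e :=
    exists_add_mul_of_cast_eq (by simp)
  have h1 := hq (((a + k : ℤ) : ZMod n).val : ℤ)
  have h2 : W a = W ((((a + k : ℤ) : ZMod n).val : ℤ) - k) + n * e := by
    rw [← periodicPerms_add_mul hW]
    congr 1
    linear_combination he
  rw [h2, h1]
  simp only [Equiv.Perm.mul_apply, Equiv.coe_addRight, transl_apply]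
  linear_combination -he

end Periodic

/-! ### Words and their permutations of the integers -/

section Words

variable {n : ℕ} [Fact (3 ≤ n)]

theorem zmodTwoNeZero (n : ℕ) [h : Fact (3 ≤ n)] : (2 : ZMod n) ≠ 0 := by
  have h := h.out
  intro h2
  have : ((2 : ℕ) : ZMod n) = 0 := by exact_mod_cast h2
  exact absurd (Nat.le_of_dvd (by norm_num) ((ZMod.natCast_eq_zero_iff 2 n).1 this)) (by omega)

theorem simplePerm_apply (i : ZMod n) (a : ℤ) : simplePerm i a = simpleFun i a := rfl

theorem simplePerm_of_eq {i : ZMod n} {a : ℤ} (h : (a : ZMod n) = i) :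
    simplePerm i a = a + 1 := by
  simp [simplePerm_apply, simpleFun, h]

theorem simplePerm_succ_of_eq {i : ZMod n} {a : ℤ} (h : (a : ZMod n) = i) :
    simplePerm i (a + 1) = a := by
  simp [simplePerm_apply, simpleFun, h, zmodOneNeZero]

theorem simplePerm_of_ne {i : ZMod n} {a : ℤ} (h : (a : ZMod n) ≠ i)
    (h' : (a : ZMod n) ≠ i + 1) : simplePerm i a = a := by
  simp [simplePerm_apply, simpleFun, h, h']

theorem simplePerm_mul_self (i : ZMod n) : simplePerm i * simplePerm i = 1 :=
  Equiv.ext fun a => simpleFun_involutive i a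

theorem simplePerm_inv (i : ZMod n) : (simplePerm i)⁻¹ = simplePerm i :=
  inv_eq_of_mul_eq_one_left (simplePerm_mul_self i)

theorem simplePerm_mem_periodicPerms (i : ZMod n) : simplePerm i ∈ periodicPerms n := fun a => by
  simp only [simplePerm_apply, simpleFun]
  push_cast
  simp only [CharP.cast_eq_zero, add_zero]
  split_ifs <;> ring

/-- The simple transpositions preserve the order of any two integers that they do not
exchange. -/
theorem simplePerm_lt {i : ZMod n} {a b : ℤ} (h : a < b)
    (h' : ¬((a : ZMod n) = i ∧ b = a + 1)) : simplePerm i a < simplePerm i b := by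
  have h1 := zmodOneNeZero n
  have h2 : b = a + 1 → (b : ZMod n) = a + 1 := by rintro rfl; simp
  have h3 : a + 1 = b ∨ a + 1 < b := by omega
  simp only [simplePerm_apply, simpleFun]
  rcases h3 with rfl | h3
  · have h4 : (a : ZMod n) ≠ i := fun h4 => h' ⟨h4, rfl⟩
    push_cast
    split_ifs with e1 e2 e3 <;> first | omega | simp_all
  · have h5 : ¬(b = a + 2 ∧ (a : ZMod n) = i ∧ (b : ZMod n) = i + 1) := by
      rintro ⟨rfl, e1, e2⟩
      push_cast at e2
      rw [e1] at e2
      exact h1 (by linear_combination e2)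
    split_ifs with e1 e2 e3 e4 e5 e6 <;> first | omega | skip
    · by_contra hc
      exact h5 ⟨by omega, e1, e3⟩

theorem wordPerm_nil : wordPerm ([] : List (ZMod n)) = 1 := rfl

theorem wordPerm_cons (i : ZMod n) (ω : List (ZMod n)) :
    wordPerm (i :: ω) = simplePerm i * wordPerm ω := rfl

theorem wordPerm_append (ω ω' : List (ZMod n)) :
    wordPerm (ω ++ ω') = wordPerm ω * wordPerm ω' := by
  simp [wordPerm]

theorem wordPerm_mem_periodicPerms (ω : List (ZMod n)) : wordPerm ω ∈ periodicPerms n := by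
  induction ω with
  | nil => exact one_mem _
  | cons i ω ih => exact mul_mem (simplePerm_mem_periodicPerms i) ih

/-- On residues a word acts by its image in the symmetric group. -/
theorem cast_wordPerm (ω : List (ZMod n)) (a : ℤ) :
    (wordPerm ω a : ZMod n) = finPerm ω (a : ZMod n) := by
  induction ω generalizing a with
  | nil => rfl
  | cons i ω ih =>
    simp only [wordPerm_cons, Equiv.Perm.mul_apply, finPerm, List.map_cons, List.prod_cons]
    rw [← finPerm, ← ih]
    simp only [simplePerm_apply, simpleFun, Equiv.swap_apply_def]
    split_ifs with h1 h2 <;> simp_all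

theorem simplePerm_add (i : ZMod n) (r : ℤ) :
    simplePerm (i + (r : ZMod n)) = Equiv.addRight r * simplePerm i * Equiv.addRight (-r) := by
  ext a
  simp only [simplePerm_apply, simpleFun, Equiv.Perm.mul_apply, Equiv.coe_addRight]
  push_cast
  simp only [← sub_eq_add_neg, sub_eq_iff_eq_add, add_right_comm i (r : ZMod n) 1]
  split_ifs <;> ring

theorem wordPerm_rot (ω : List (ZMod n)) (r : ℤ) :
    wordPerm (rot (r : ZMod n) ω) = Equiv.addRight r * wordPerm ω * Equiv.addRight (-r) := by
  induction ω with
  | nil => simp [rot, wordPerm_nil, addRight_mul]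
  | cons i ω ih =>
    have : rot (r : ZMod n) (i :: ω) = (i + r) :: rot (r : ZMod n) ω := rfl
    rw [this, wordPerm_cons, ih, simplePerm_add, wordPerm_cons]
    ext a
    simp [Equiv.Perm.mul_apply]

/-- Generators that are not neighbours commute. -/
theorem simplePerm_comm {i j : ZMod n} (h1 : i - j ≠ 1) (h2 : j - i ≠ 1) :
    simplePerm i * simplePerm j = simplePerm j * simplePerm i := by
  have h1' : i ≠ j + 1 := fun h => h1 (by rw [h]; ring)
  have h2' : j ≠ i + 1 := fun h => h2 (by rw [h]; ring)
  rcases eq_or_ne i j with rfl | hij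
  · rfl
  have hij' : i + 1 ≠ j + 1 := fun h => hij (by simpa using h)
  ext a
  simp only [Equiv.Perm.mul_apply]
  by_cases ai : (a : ZMod n) = i
  · rw [simplePerm_of_eq ai, simplePerm_of_ne (a := a) (by rwa [ai]) (by rwa [ai]),
      simplePerm_of_eq ai, simplePerm_of_ne] <;> push_cast <;> rw [ai]
    · exact h2'.symm
    · exact hij'
  by_cases ai' : (a : ZMod n) = i + 1
  · obtain ⟨a, rfl⟩ : ∃ a', a = a' + 1 := ⟨a - 1, by ring⟩
    have e : (a : ZMod n) = i := by push_cast at ai'; simpa using ai'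
    rw [simplePerm_succ_of_eq e, simplePerm_of_ne (a := a + 1), simplePerm_succ_of_eq e,
      simplePerm_of_ne] <;> push_cast <;> rw [e]
    · exact hij
    · exact h1'
    · exact h2'.symm
    · exact hij'
  by_cases aj : (a : ZMod n) = j
  · rw [simplePerm_of_eq aj, simplePerm_of_ne ai ai', simplePerm_of_eq aj, simplePerm_of_ne]
      <;> push_cast <;> rw [aj]
    · exact h1'.symm
    · exact hij'.symm
  by_cases aj' : (a : ZMod n) = j + 1
  · obtain ⟨a, rfl⟩ : ∃ a', a = a' + 1 := ⟨a - 1, by ring⟩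
    have e : (a : ZMod n) = j := by push_cast at aj'; simpa using aj'
    rw [simplePerm_of_ne ai ai', simplePerm_succ_of_eq e, simplePerm_of_ne] <;> rw [e]
    · exact hij.symm
    · exact h2'
  rw [simplePerm_of_ne aj aj', simplePerm_of_ne ai ai', simplePerm_of_ne aj aj']

/-- The values of two neighbouring generators at three consecutive integers. -/
theorem simplePerm_neighbours {i : ZMod n} {a : ℤ} (ha : (a : ZMod n) = i) :
    (simplePerm i a = a + 1 ∧ simplePerm i (a + 1) = a ∧ simplePerm i (a + 2) = a + 2) ∧
      (simplePerm (i + 1) a = a ∧ simplePerm (i + 1) (a + 1) = a + 2 ∧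
        simplePerm (i + 1) (a + 2) = a + 1) := by
  have h1 := zmodOneNeZero n
  have h2 := zmodTwoNeZero n
  have e2 : i + 1 + 1 = i + 2 := by ring
  have ha1 : ((a + 1 : ℤ) : ZMod n) = i + 1 := by push_cast; rw [ha]
  refine ⟨⟨simplePerm_of_eq ha, simplePerm_succ_of_eq ha, ?_⟩, ?_, ?_, ?_⟩
  · apply simplePerm_of_ne <;> push_cast <;> rw [ha]
    · simpa using h2
    · rw [← e2]; simpa using h1
  · apply simplePerm_of_ne <;> rw [ha]
    · simpa using h1
    · simpa [e2] using h2
  · rw [simplePerm_of_eq ha1]; ring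
  · rw [← simplePerm_succ_of_eq ha1]; congr 1; ring

/-- Neighbouring generators satisfy the braid relation. -/
theorem simplePerm_braid (i : ZMod n) :
    simplePerm i * simplePerm (i + 1) * simplePerm i =
      simplePerm (i + 1) * simplePerm i * simplePerm (i + 1) := by
  have e2 : i + 1 + 1 = i + 2 := by ring
  ext a
  simp only [Equiv.Perm.mul_apply]
  by_cases a0 : (a : ZMod n) = i
  · obtain ⟨⟨k1, k2, k3⟩, k4, k5, k6⟩ := simplePerm_neighbours a0
    rw [k1, k5, k3, k4, k1, k5]
  by_cases a1 : (a : ZMod n) = i + 1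
  · obtain ⟨b, rfl⟩ : ∃ b, a = b + 1 := ⟨a - 1, by ring⟩
    obtain ⟨⟨k1, k2, k3⟩, k4, k5, k6⟩ :=
      simplePerm_neighbours (i := i) (a := b) (by push_cast at a1; simpa using a1)
    rw [k2, k4, k1, k5, k3, k6]
  by_cases a2 : (a : ZMod n) = i + 2
  · obtain ⟨b, rfl⟩ : ∃ b, a = b + 2 := ⟨a - 2, by ring⟩
    obtain ⟨⟨k1, k2, k3⟩, k4, k5, k6⟩ :=
      simplePerm_neighbours (i := i) (a := b) (by push_cast at a2; simpa using a2)
    rw [k3, k6, k2, k4]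
  rw [simplePerm_of_ne a0 a1, simplePerm_of_ne a1 (by rwa [e2]), simplePerm_of_ne a0 a1,
    simplePerm_of_ne a1 (by rwa [e2])]

end Words

/-! ### Ascending words and Matsumoto's theorem -/

section Ascending

variable {n : ℕ}

/-- The wires in the positions `a` and `a + 1`, `a ≡ i`, are in increasing order. -/
def IsAscent (W : Equiv.Perm ℤ) (i : ZMod n) : Prop :=
  ∀ a : ℤ, (a : ZMod n) = i → W a < W (a + 1)

theorem isAscent_iff {W : Equiv.Perm ℤ} (hW : W ∈ periodicPerms n) {i : ZMod n} {a : ℤ}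
    (ha : (a : ZMod n) = i) : IsAscent W i ↔ W a < W (a + 1) :=
  ⟨fun h => h a ha, fun h _ hb => (periodicPerms_lt_congr hW (ha.trans hb.symm)).1 h⟩

theorem not_isAscent_iff {W : Equiv.Perm ℤ} (hW : W ∈ periodicPerms n) {i : ZMod n} {a : ℤ}
    (ha : (a : ZMod n) = i) : ¬IsAscent W i ↔ W (a + 1) < W a := by
  have : W a ≠ W (a + 1) := fun h => by simpa using W.injective h
  rw [isAscent_iff hW ha]
  omega

/-- One application of the braid or commutation relations inside a word. -/
inductive BraidMove : List (ZMod n) → List (ZMod n) → Prop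
  | braid (L R : List (ZMod n)) (i j : ZMod n) (hij : i - j = 1 ∨ j - i = 1) :
      BraidMove (L ++ [i, j, i] ++ R) (L ++ [j, i, j] ++ R)
  | comm (L R : List (ZMod n)) (i j : ZMod n) (h0 : i ≠ j) (h1 : i - j ≠ 1) (h2 : j - i ≠ 1) :
      BraidMove (L ++ [i, j] ++ R) (L ++ [j, i] ++ R)

/-- Two words are connected by braid and commutation moves. -/
abbrev BraidEquiv : List (ZMod n) → List (ZMod n) → Prop := Relation.ReflTransGen BraidMove

theorem BraidMove.append {ω ω' : List (ZMod n)} (h : BraidMove ω ω') (S : List (ZMod n)) :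
    BraidMove (ω ++ S) (ω' ++ S) := by
  cases h with
  | braid L R i j hij => simpa using BraidMove.braid L (R ++ S) i j hij
  | comm L R i j h0 h1 h2 => simpa using BraidMove.comm L (R ++ S) i j h0 h1 h2

theorem BraidEquiv.append {ω ω' : List (ZMod n)} (h : BraidEquiv ω ω') (S : List (ZMod n)) :
    BraidEquiv (ω ++ S) (ω' ++ S) :=
  Relation.ReflTransGen.lift (· ++ S) (fun _ _ h => BraidMove.append h S) _ _ h

theorem BraidMove.length_eq {ω ω' : List (ZMod n)} (h : BraidMove ω ω') :
    ω.length = ω'.length := by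
  cases h <;> simp

theorem BraidEquiv.length_eq {ω ω' : List (ZMod n)} (h : BraidEquiv ω ω') :
    ω.length = ω'.length := by
  induction h with
  | refl => rfl
  | tail _ h ih => exact ih.trans h.length_eq

variable [Fact (3 ≤ n)]

/-- A word is ascending if, drawn with the identity wiring on its left, each of its crossings
moves a smaller wire up.  This is the combinatorial form of being reduced: no two wires cross
twice. -/
def IsAscending (ω : List (ZMod n)) : Prop :=
  ∀ L i R, ω = L ++ i :: R → IsAscent (wordPerm L) i

theorem isAscending_nil : IsAscending ([] : List (ZMod n)) := by
  intro L i R h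
  simp at h

theorem isAscending_concat {ω : List (ZMod n)} {i : ZMod n} :
    IsAscending (ω ++ [i]) ↔ IsAscending ω ∧ IsAscent (wordPerm ω) i := by
  refine ⟨fun h => ⟨?_, h ω i [] rfl⟩, ?_⟩
  · rintro L j R rfl
    exact h L j (R ++ [i]) (by simp)
  · rintro ⟨h, hi⟩ L j R e
    rcases List.eq_nil_or_concat R with rfl | ⟨R, k, rfl⟩
    · obtain ⟨rfl, e⟩ := List.append_inj' e rfl
      obtain rfl : i = j := by simpa using e
      exact hi
    · refine h L j R ?_
      rw [List.concat_eq_append, ← List.cons_append, ← List.append_assoc] at e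
      exact (List.append_inj' e rfl).1

theorem wordPerm_concat (ω : List (ZMod n)) (i : ZMod n) :
    wordPerm (ω ++ [i]) = wordPerm ω * simplePerm i := by
  rw [wordPerm_append, wordPerm_cons, wordPerm_nil, mul_one]

theorem wordPerm_concat_apply (ω : List (ZMod n)) (i : ZMod n) (a : ℤ) :
    wordPerm (ω ++ [i]) a = wordPerm ω (simplePerm i a) := by
  rw [wordPerm_concat, Equiv.Perm.mul_apply]

/-- The last letter of an ascending word is a descent of its permutation. -/
theorem not_isAscent_of_isAscending {ω : List (ZMod n)} {i : ZMod n}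
    (h : IsAscent (wordPerm ω) i) : ¬IsAscent (wordPerm (ω ++ [i])) i := by
  have ha : ((i.val : ℤ) : ZMod n) = i := by simp
  rw [not_isAscent_iff (wordPerm_mem_periodicPerms _) ha, wordPerm_concat_apply,
    wordPerm_concat_apply, simplePerm_of_eq ha, simplePerm_succ_of_eq ha]
  exact h _ ha

theorem BraidMove.wordPerm_eq {ω ω' : List (ZMod n)} (h : BraidMove ω ω') :
    wordPerm ω = wordPerm ω' := by
  cases h with
  | braid L R i j hij =>
    have e : wordPerm [i, j, i] = wordPerm [j, i, j] := by
      simp only [wordPerm_cons, wordPerm_nil, mul_one, ← mul_assoc]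
      rcases hij with h | h
      · obtain rfl : i = j + 1 := by rw [← h]; ring
        exact (simplePerm_braid j).symm
      · obtain rfl : j = i + 1 := by rw [← h]; ring
        exact simplePerm_braid i
    simp only [wordPerm_append, e]
  | comm L R i j h0 h1 h2 =>
    have e : wordPerm [i, j] = wordPerm [j, i] := by
      simp only [wordPerm_cons, wordPerm_nil, mul_one]
      exact simplePerm_comm h1 h2
    simp only [wordPerm_append, e]

theorem BraidEquiv.wordPerm_eq {ω ω' : List (ZMod n)} (h : BraidEquiv ω ω') :
    wordPerm ω = wordPerm ω' := by
  induction h with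
  | refl => rfl
  | tail _ h ih => exact ih.trans h.wordPerm_eq

/-- Exchange property: braid moves bring any descent of an ascending word to its end. -/
theorem exists_braidEquiv_concat (ω : List (ZMod n)) (hω : IsAscending ω) (j : ZMod n)
    (hj : ¬IsAscent (wordPerm ω) j) :
    ∃ ω' : List (ZMod n), IsAscending (ω' ++ [j]) ∧ BraidEquiv ω (ω' ++ [j]) := by
  induction hl : ω.length using Nat.strong_induction_on generalizing ω j with
  | _ l IH =>
  have hmem := @wordPerm_mem_periodicPerms n _
  rcases List.eq_nil_or_concat ω with rfl | ⟨ω₁, i, rfl⟩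
  · exact absurd (fun a _ => by simp [wordPerm_nil]) hj
  rw [List.concat_eq_append] at *
  subst hl
  rcases eq_or_ne i j with rfl | hij
  · exact ⟨ω₁, hω, .refl⟩
  obtain ⟨h₁, hi⟩ := isAscending_concat.1 hω
  by_cases hadj : i - j = 1 ∨ j - i = 1
  · -- `ω₁ i ~ ω₂ j i ~ ω₃ i j i ~ ω₃ j i j`
    have key (ω₃ : List (ZMod n)) {ω₂ : List (ZMod n)} (e₁ : BraidEquiv ω₁ (ω₂ ++ [j]))
        (e₂ : BraidEquiv ω₂ (ω₃ ++ [i])) (h : IsAscending (ω₃ ++ [j] ++ [i] ++ [j])) :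
        ∃ ω' : List (ZMod n), IsAscending (ω' ++ [j]) ∧ BraidEquiv (ω₁ ++ [i]) (ω' ++ [j]) := by
      refine ⟨_, h, (e₁.append _).trans (((e₂.append _).append _).trans ?_)⟩
      simpa using Relation.ReflTransGen.single (BraidMove.braid ω₃ [] i j hadj)
    rcases hadj with h | h
    · obtain rfl : i = j + 1 := by rw [← h]; ring
      clear h
      have ha : ((j.val : ℤ) : ZMod n) = j := by simp
      set a : ℤ := (j.val : ℤ)
      have ha1 : ((a + 1 : ℤ) : ZMod n) = j + 1 := by push_cast; rw [ha]
      have e2 : a + 1 + 1 = a + 2 := by ring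
      obtain ⟨⟨k1, k2, k3⟩, k4, k5, k6⟩ := simplePerm_neighbours ha
      rw [isAscent_iff (hmem _) ha1, e2] at hi
      rw [not_isAscent_iff (hmem _) ha, wordPerm_concat_apply, wordPerm_concat_apply, k4, k5] at hj
      obtain ⟨ω₂, g₂, e₁⟩ := IH ω₁.length (by simp) ω₁ h₁ j
        ((not_isAscent_iff (hmem _) ha).2 (hi.trans hj)) rfl
      have l₁ := e₁.length_eq
      have w₁ := e₁.wordPerm_eq
      rw [w₁] at hi hj
      simp only [wordPerm_concat_apply, k1, k2, k3] at hi hj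
      obtain ⟨ω₃, g₃, e₂⟩ := IH ω₂.length (by simp_all) ω₂ (isAscending_concat.1 g₂).1 (j + 1)
        ((not_isAscent_iff (hmem _) ha1).2 (by rw [e2]; exact hj)) rfl
      have w₂ := e₂.wordPerm_eq
      have g₂' := (isAscent_iff (hmem _) ha).1 (isAscending_concat.1 g₂).2
      rw [w₂] at hi hj g₂'
      simp only [wordPerm_concat_apply, k4, k5, k6] at hi hj g₂'
      refine key ω₃ e₁ e₂ ?_
      simp only [isAscending_concat, isAscent_iff (hmem _) ha, isAscent_iff (hmem _) ha1, e2,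
        wordPerm_concat_apply, k1, k2, k3, k4, k5]
      exact ⟨⟨⟨(isAscending_concat.1 g₃).1, hi⟩, g₂'⟩, hj⟩
    · obtain rfl : j = i + 1 := by rw [← h]; ring
      clear h
      have ha : ((i.val : ℤ) : ZMod n) = i := by simp
      set a : ℤ := (i.val : ℤ)
      have ha1 : ((a + 1 : ℤ) : ZMod n) = i + 1 := by push_cast; rw [ha]
      have e2 : a + 1 + 1 = a + 2 := by ring
      obtain ⟨⟨k1, k2, k3⟩, k4, k5, k6⟩ := simplePerm_neighbours ha
      rw [isAscent_iff (hmem _) ha] at hi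
      rw [not_isAscent_iff (hmem _) ha1, e2, wordPerm_concat_apply, wordPerm_concat_apply, k2,
        k3] at hj
      obtain ⟨ω₂, g₂, e₁⟩ := IH ω₁.length (by simp) ω₁ h₁ (i + 1)
        ((not_isAscent_iff (hmem _) ha1).2 (by rw [e2]; exact hj.trans hi)) rfl
      have w₁ := e₁.wordPerm_eq
      have l₁ := e₁.length_eq
      rw [w₁] at hi hj
      simp only [wordPerm_concat_apply, k4, k5, k6] at hi hj
      obtain ⟨ω₃, g₃, e₂⟩ := IH ω₂.length (by simp_all) ω₂ (isAscending_concat.1 g₂).1 i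
        ((not_isAscent_iff (hmem _) ha).2 hj) rfl
      have w₂ := e₂.wordPerm_eq
      have g₂' := (isAscent_iff (hmem _) ha1).1 (isAscending_concat.1 g₂).2
      rw [e2] at g₂'
      rw [w₂] at hi hj g₂'
      simp only [wordPerm_concat_apply, k1, k2, k3] at hi hj g₂'
      refine key ω₃ e₁ e₂ ?_
      simp only [isAscending_concat, isAscent_iff (hmem _) ha, isAscent_iff (hmem _) ha1, e2,
        wordPerm_concat_apply, k2, k3, k4, k5, k6]
      exact ⟨⟨⟨(isAscending_concat.1 g₃).1, hi⟩, g₂'⟩, hj⟩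
  · -- `ω₁ i ~ ω₂ j i ~ ω₂ i j`
    push Not at hadj
    obtain ⟨n1, n2⟩ := hadj
    have d1 : i ≠ j + 1 := fun h => n1 (by rw [h]; ring)
    have d2 : j ≠ i + 1 := fun h => n2 (by rw [h]; ring)
    have d3 : i + 1 ≠ j + 1 := fun h => hij (by simpa using h)
    have ha : ((i.val : ℤ) : ZMod n) = i := by simp
    have hb : ((j.val : ℤ) : ZMod n) = j := by simp
    set a : ℤ := (i.val : ℤ)
    set b : ℤ := (j.val : ℤ)
    have k1 : simplePerm i b = b := simplePerm_of_ne (by rw [hb]; exact hij.symm) (by rwa [hb])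
    have k2 : simplePerm i (b + 1) = b + 1 := by
      apply simplePerm_of_ne <;> push_cast <;> rw [hb]
      exacts [d1.symm, d3.symm]
    have k3 : simplePerm j a = a := simplePerm_of_ne (by rwa [ha]) (by rwa [ha])
    have k4 : simplePerm j (a + 1) = a + 1 := by
      apply simplePerm_of_ne <;> push_cast <;> rw [ha]
      exacts [d2.symm, d3]
    rw [isAscent_iff (hmem _) ha] at hi
    rw [not_isAscent_iff (hmem _) hb, wordPerm_concat_apply, wordPerm_concat_apply, k1, k2] at hj
    obtain ⟨ω₂, g₂, e₁⟩ := IH ω₁.length (by simp) ω₁ h₁ j ((not_isAscent_iff (hmem _) hb).2 hj) rfl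
    have w₁ := e₁.wordPerm_eq
    have g₂' := isAscending_concat.1 g₂
    rw [isAscent_iff (hmem _) hb] at g₂'
    rw [w₁] at hi
    simp only [wordPerm_concat_apply, k3, k4] at hi
    refine ⟨ω₂ ++ [i], ?_, (e₁.append _).trans ?_⟩
    · simp only [isAscending_concat, isAscent_iff (hmem _) ha, isAscent_iff (hmem _) hb,
        wordPerm_concat_apply, k1, k2]
      exact ⟨⟨g₂'.1, hi⟩, g₂'.2⟩
    · simpa using Relation.ReflTransGen.single (BraidMove.comm ω₂ [] j i hij.symm n2 n1)

/-- Matsumoto's theorem: ascending words for the same permutation are connected by braid moves. -/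
theorem braidEquiv_of_isAscending {ω ω' : List (ZMod n)} (h : IsAscending ω)
    (h' : IsAscending ω') (e : wordPerm ω = wordPerm ω') : BraidEquiv ω ω' := by
  induction ω' using List.reverseRecOn generalizing ω with
  | nil =>
    rcases List.eq_nil_or_concat ω with rfl | ⟨ω₁, i, rfl⟩
    · exact .refl
    · rw [List.concat_eq_append] at *
      refine absurd ?_ (not_isAscent_of_isAscending (isAscending_concat.1 h).2)
      rw [e]
      exact fun a _ => by simp [wordPerm_nil]
  | append_singleton ω₁ j ih =>
    obtain ⟨h₁, hj⟩ := isAscending_concat.1 h'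
    obtain ⟨ω₂, h₂, e₂⟩ := exists_braidEquiv_concat ω h j
      (by rw [e]; exact not_isAscent_of_isAscending hj)
    refine e₂.trans ((ih (isAscending_concat.1 h₂).1 h₁ ?_).append _)
    have := e₂.wordPerm_eq.symm.trans e
    rwa [wordPerm_concat, wordPerm_concat, mul_left_inj] at this

/-- The permutation of a word is that of an ascending word, which is shorter unless the given word
is itself ascending. -/
theorem exists_isAscending (ω : List (ZMod n)) :
    ∃ ω' : List (ZMod n), IsAscending ω' ∧ wordPerm ω' = wordPerm ω ∧ ω'.length ≤ ω.length ∧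
      (ω'.length = ω.length → IsAscending ω) := by
  induction ω using List.reverseRecOn with
  | nil => exact ⟨[], isAscending_nil, rfl, le_rfl, fun _ => isAscending_nil⟩
  | append_singleton ω j ih =>
    obtain ⟨ω', h', e, hl, hs⟩ := ih
    by_cases hj : IsAscent (wordPerm ω') j
    · refine ⟨ω' ++ [j], isAscending_concat.2 ⟨h', hj⟩, by rw [wordPerm_concat, wordPerm_concat, e],
        by simpa, fun h => isAscending_concat.2 ⟨hs (by simpa using h), by rwa [← e]⟩⟩
    · obtain ⟨ω₂, h₂, e₂⟩ := exists_braidEquiv_concat ω' h' j hj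
      have hl₂ := e₂.length_eq
      have hw₂ := e₂.wordPerm_eq
      simp only [List.length_append, List.length_cons, List.length_nil] at hl₂
      refine ⟨ω₂, (isAscending_concat.1 h₂).1, ?_, ?_, fun h => ?_⟩
      · rw [wordPerm_concat, ← e, hw₂, wordPerm_concat, mul_assoc, simplePerm_mul_self, mul_one]
      · simp; omega
      · simp at h; omega

/-- A word that has the permutation and the length of an ascending word is connected with it by
braid moves. -/
theorem braidEquiv_of_wordPerm_eq {ω ω' : List (ZMod n)} (h : IsAscending ω)
    (e : wordPerm ω = wordPerm ω') (hl : ω.length = ω'.length) : BraidEquiv ω ω' := by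
  obtain ⟨ω₁, h₁, e₁, -, hs⟩ := exists_isAscending ω'
  refine braidEquiv_of_isAscending h (hs ?_) e
  rw [← hl, (braidEquiv_of_isAscending h h₁ (e.trans e₁.symm)).length_eq]

end Ascending

/-! ### Crossings of a wiring diagram -/

section Crossings

variable {n : ℕ} [Fact (3 ≤ n)]

theorem wiringAt_mem_periodicPerms {g : Equiv.Perm ℤ} (hg : g ∈ periodicPerms n)
    (ω : List (ZMod n)) (p : Fin ω.length) : wiringAt g ω p ∈ periodicPerms n :=
  mul_mem hg (wordPerm_mem_periodicPerms _)

theorem cast_crossPos (ω : List (ZMod n)) (p : Fin ω.length) :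
    (crossPos ω p : ZMod n) = ω.get p := by
  simp [crossPos]

/-- The wires that cross at the letter `i` of `L i R`, computed from any lift `c` of `i`. -/
theorem exists_crossing_of_split {g : Equiv.Perm ℤ} (hg : g ∈ periodicPerms n)
    (L R : List (ZMod n)) {i : ZMod n} {c : ℤ} (hc : (c : ZMod n) = i) :
    ∃ p : Fin (L ++ i :: R).length, lowerWire g (L ++ i :: R) p = ((g (wordPerm L c) : ℤ) : ZMod n)
      ∧ upperWire g (L ++ i :: R) p = ((g (wordPerm L (c + 1)) : ℤ) : ZMod n) := by
  have hp : L.length < (L ++ i :: R).length := by simp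
  have hW := wiringAt_mem_periodicPerms hg (L ++ i :: R) ⟨L.length, hp⟩
  have e : wiringAt g (L ++ i :: R) ⟨L.length, hp⟩ = g * wordPerm L := by simp [wiringAt]
  have e' : (crossPos (L ++ i :: R) ⟨L.length, hp⟩ : ZMod n) = c := by
    rw [cast_crossPos, hc]; simp
  refine ⟨⟨L.length, hp⟩, ?_, ?_⟩
  · rw [lowerWire, periodicPerms_cast_congr hW e', e, Equiv.Perm.mul_apply]
  · rw [upperWire, periodicPerms_cast_congr hW (b := c + 1) (by push_cast; rw [e']), e,
      Equiv.Perm.mul_apply]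

/-- Wires that arrive in the opposite order cross somewhere. -/
theorem exists_split_of_inversion (ω : List (ZMod n)) {a b : ℤ} (hab : a < b)
    (h : (wordPerm ω)⁻¹ b < (wordPerm ω)⁻¹ a) :
    ∃ (L : List (ZMod n)) (i : ZMod n) (R : List (ZMod n)) (c : ℤ),
      ω = L ++ i :: R ∧ (c : ZMod n) = i ∧ wordPerm L c = a ∧ wordPerm L (c + 1) = b := by
  induction ω using List.reverseRecOn with
  | nil => simp [wordPerm_nil] at h; omega
  | append_singleton ω i ih =>
    by_cases h' : (wordPerm ω)⁻¹ b < (wordPerm ω)⁻¹ a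
    · obtain ⟨L, j, R, c, rfl, hc⟩ := ih h'
      exact ⟨L, j, R ++ [i], c, by simp, hc⟩
    · rw [wordPerm_concat, mul_inv_rev, simplePerm_inv, Equiv.Perm.mul_apply,
        Equiv.Perm.mul_apply] at h
      have hne : (wordPerm ω)⁻¹ a ≠ (wordPerm ω)⁻¹ b := fun e =>
        hab.ne ((wordPerm ω)⁻¹.injective e)
      have hlt : (wordPerm ω)⁻¹ a < (wordPerm ω)⁻¹ b := by omega
      by_contra hc
      refine absurd (simplePerm_lt (i := i) hlt fun hh => hc ?_) (by omega)
      refine ⟨ω, i, [], _, rfl, hh.1, by simp, ?_⟩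
      rw [← hh.2]
      simp

theorem exists_crossing_of_inversion {g : Equiv.Perm ℤ} (hg : g ∈ periodicPerms n)
    (ω : List (ZMod n)) {a b : ℤ} (hab : a < b) (h : (wordPerm ω)⁻¹ b < (wordPerm ω)⁻¹ a) :
    ∃ p : Fin ω.length, lowerWire g ω p = ((g a : ℤ) : ZMod n) ∧
      upperWire g ω p = ((g b : ℤ) : ZMod n) := by
  obtain ⟨L, i, R, c, rfl, hc, rfl, rfl⟩ := exists_split_of_inversion ω hab h
  exact exists_crossing_of_split hg L R hc

/-- If the weights increase from the lower to the upper wire at every crossing, then no two wires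
cross twice. -/
theorem isAscending_of_weights {g : Equiv.Perm ℤ} (hg : g ∈ periodicPerms n) (α : ZMod n → ℝ)
    {ω : List (ZMod n)} (h : ∀ p, α (lowerWire g ω p) < α (upperWire g ω p)) :
    IsAscending ω := by
  rintro L i R rfl a ha
  by_contra hlt
  have hne : wordPerm L (a + 1) ≠ wordPerm L a := fun e => by simpa using (wordPerm L).injective e
  obtain ⟨L₁, j, R₁, c, rfl, hc, e₁, e₂⟩ := exists_split_of_inversion L
    (a := wordPerm L (a + 1)) (b := wordPerm L a) (by omega) (by simp)
  obtain ⟨p, p₁, p₂⟩ := exists_crossing_of_split hg L₁ (R₁ ++ i :: R) hc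
  obtain ⟨q, q₁, q₂⟩ := exists_crossing_of_split hg (L₁ ++ j :: R₁) R ha
  have h₁ := h q
  rw [q₁, q₂] at h₁
  rw [e₁] at p₁
  rw [e₂] at p₂
  have h₂ : α (lowerWire g (L₁ ++ j :: (R₁ ++ i :: R)) p) <
      α (upperWire g (L₁ ++ j :: (R₁ ++ i :: R)) p) := by
    have key : ∀ ω', ω' = L₁ ++ j :: R₁ ++ i :: R → ∀ p : Fin ω'.length,
        α (lowerWire g ω' p) < α (upperWire g ω' p) := by
      rintro _ rfl; exact h
    exact key _ (by simp) p
  rw [p₁, p₂] at h₂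
  exact lt_asymm h₁ h₂

end Crossings

/-! ### Lattice vectors of chambers -/

section LatticeVec

variable {n : ℕ}

/-- The lattice vector of the chamber above position `p` in the wiring `W`. -/
noncomputable def wiringVec (n : ℕ) (W : Equiv.Perm ℤ) (p : ℤ) : ZMod n → ℤ :=
  latticeVec n (W '' Set.Iic p)

theorem wiringVec_mul_addRight (W : Equiv.Perm ℤ) (k p : ℤ) :
    wiringVec n (W * Equiv.addRight k) p = wiringVec n W (p + k) := by
  rw [wiringVec, wiringVec]
  congr 1
  ext a
  constructor
  · rintro ⟨b, hb, rfl⟩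
    exact ⟨b + k, by simpa using hb, rfl⟩
  · rintro ⟨b, hb, rfl⟩
    exact ⟨b - k, by simp only [Set.mem_Iic] at *; omega, by simp⟩

variable [Fact (3 ≤ n)] {W : Equiv.Perm ℤ}

/-- The highest wire with residue `j` below the chamber above position `p` sits at the position
`b ∈ (p - n, p]`. -/
theorem wiringVec_apply (hW : W ∈ periodicPerms n) {p b : ℤ} {j : ZMod n}
    (hb : (W b : ZMod n) = j) (h1 : b ≤ p) (h2 : p < b + n) :
    wiringVec n W p j = ⌈((W b : ℤ) : ℚ) / (n : ℚ)⌉ := by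
  have : IsGreatest {a : ℤ | a ∈ W '' Set.Iic p ∧ (a : ZMod n) = j} (W b) := by
    refine ⟨⟨⟨b, h1, rfl⟩, hb⟩, ?_⟩
    rintro _ ⟨⟨a, ha, rfl⟩, hj⟩
    obtain ⟨q, rfl⟩ := exists_add_mul_of_cast_eq (periodicPerms_cast_inj hW (hb.trans hj.symm))
    rw [periodicPerms_add_mul hW]
    have hn : 0 < (n : ℤ) := by exact_mod_cast Nat.pos_of_neZero n
    have ha : b + n * q ≤ p := ha
    have : q ≤ 0 := by
      by_contra hq
      have : (n : ℤ) * 1 ≤ n * q := by gcongr; omega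
      omega
    nlinarith
  rw [wiringVec, latticeVec, this.csSup_eq]

theorem exists_position (hW : W ∈ periodicPerms n) (p : ℤ) (j : ZMod n) :
    ∃ b : ℤ, (W b : ZMod n) = j ∧ b ≤ p ∧ p < b + n := by
  have hn : 0 < (n : ℤ) := by exact_mod_cast Nat.pos_of_neZero n
  set c : ℤ := W⁻¹ (j.val : ℤ) with hc
  refine ⟨c + n * ((p - c) / n), ?_, ?_, ?_⟩
  · rw [periodicPerms_add_mul hW]
    simp [hc]
  · have := Int.mul_ediv_self_le (x := p - c) hn.ne'
    omega
  · have := Int.lt_mul_ediv_self_add (x := p - c) hn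
    omega

theorem ceil_add_mul_div (a q : ℤ) :
    ⌈((a + n * q : ℤ) : ℚ) / (n : ℚ)⌉ = ⌈(a : ℚ) / (n : ℚ)⌉ + q := by
  have hn : (n : ℚ) ≠ 0 := by exact_mod_cast NeZero.ne n
  rw [← Int.ceil_add_intCast]
  congr 1
  push_cast
  field_simp

theorem wiringVec_step (hW : W ∈ periodicPerms n) {p q : ℤ} (hpq : q + 1 = p) :
    wiringVec n W p = wiringVec n W q + stdVec (W p : ZMod n) := by
  have hn : 3 ≤ (n : ℤ) := by exact_mod_cast (Fact.out : 3 ≤ n)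
  ext j
  rw [Pi.add_apply]
  by_cases hj : (W p : ZMod n) = j
  · have e : W (p + n * (-1)) = W p + n * (-1) := periodicPerms_add_mul hW _ _
    rw [wiringVec_apply hW hj le_rfl (by omega), wiringVec_apply hW (b := p + n * (-1)) (j := j)
      (by rw [e]; push_cast; simpa using hj) (by omega) (by omega), e, ceil_add_mul_div, hj]
    simp [stdVec]
  · obtain ⟨b, hb, h1, h2⟩ := exists_position hW p j
    have : b ≠ p := by rintro rfl; exact hj hb
    rw [wiringVec_apply hW hb h1 h2, wiringVec_apply hW hb (by omega) (by omega)]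
    simp [stdVec, Ne.symm hj]

theorem wiringVec_add_mul (hW : W ∈ periodicPerms n) (p q : ℤ) :
    wiringVec n W (p + n * q) = wiringVec n W p + fun _ => q := by
  ext j
  obtain ⟨b, hb, h1, h2⟩ := exists_position hW p j
  have e : W (b + n * q) = W b + n * q := periodicPerms_add_mul hW _ _
  rw [Pi.add_apply, wiringVec_apply hW hb h1 h2, wiringVec_apply hW (b := b + n * q) (j := j)
    (by rw [e]; push_cast; simpa using hb) (by omega) (by omega), e, ceil_add_mul_div]

theorem wiringVec_transl_mul (hW : W ∈ periodicPerms n) (m : ZMod n → ℤ) (p : ℤ) :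
    wiringVec n (transl m * W) p = wiringVec n W p + m := by
  ext j
  obtain ⟨b, hb, h1, h2⟩ := exists_position hW p j
  rw [Pi.add_apply, wiringVec_apply hW hb h1 h2, wiringVec_apply
    (mul_mem (transl_mem_periodicPerms m) hW) (b := b) (j := j)
    (by rw [Equiv.Perm.mul_apply, cast_transl, hb]) h1 h2, Equiv.Perm.mul_apply, transl_apply,
    ceil_add_mul_div, hb]

/-- A crossing changes no chamber but the one between the two wires. -/
theorem wiringVec_mul_simplePerm (W : Equiv.Perm ℤ) {i : ZMod n} {p : ℤ}
    (hp : (p : ZMod n) ≠ i) : wiringVec n (W * simplePerm i) p = wiringVec n W p := by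
  have key : ∀ a : ℤ, a ≤ p → simplePerm i a ≤ p := by
    intro a ha
    rcases ha.eq_or_lt with rfl | ha
    · simp only [simplePerm_apply, simpleFun, if_neg hp]
      split_ifs <;> omega
    · simp only [simplePerm_apply, simpleFun]
      split_ifs <;> omega
  rw [wiringVec, wiringVec]
  congr 1
  ext a
  constructor
  · rintro ⟨b, hb, rfl⟩
    exact ⟨simplePerm i b, key b hb, rfl⟩
  · rintro ⟨b, hb, rfl⟩
    exact ⟨simplePerm i b, key b hb, congrArg W (simpleFun_involutive i b)⟩

end LatticeVec

/-! ### Crossing parameters of a `τ`-function and Lusztig's relations -/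

section CrossParam

variable {n : ℕ}

/-- The parameter of a crossing with lower wire `l` and upper wire `u` above a chamber with lattice
vector `s`. -/
noncomputable def cellParam (α : ZMod n → ℝ) (τ : (ZMod n → ℤ) → ℝ) (s : ZMod n → ℤ)
    (l u : ZMod n) : ℝ :=
  (α u - α l) * (τ s * τ (s + stdVec u + stdVec l)) / (τ (s + stdVec u) * τ (s + stdVec l))

theorem cellParam_add (α : ZMod n → ℝ) (τ : (ZMod n → ℤ) → ℝ) (s m : ZMod n → ℤ) (l u : ZMod n) :
    cellParam α τ (s + m) l u = cellParam α (fun s => τ (s + m)) s l u := by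
  simp only [cellParam, add_right_comm s m, add_right_comm _ m]

/-- The parameter of the crossing of the wires in positions `c` and `c + 1` of the wiring `W`. -/
noncomputable def crossParam (α : ZMod n → ℝ) (τ : (ZMod n → ℤ) → ℝ) (W : Equiv.Perm ℤ) (c : ℤ) :
    ℝ :=
  cellParam α τ (wiringVec n W (c - 1)) ((W c : ℤ) : ZMod n) ((W (c + 1) : ℤ) : ZMod n)

theorem apply_add_const {τ : (ZMod n → ℤ) → ℝ} (hτ : ∀ s, τ (s + 1) = τ s) (s : ZMod n → ℤ)
    (q : ℤ) : τ (s + fun _ => q) = τ s := by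
  induction q with
  | zero => congr 1; ext; simp
  | succ q ih => rw [← ih, ← hτ (s + fun _ => (q : ℤ))]; congr 1; ext; simp [add_assoc]
  | pred q ih => rw [← ih, ← hτ (s + fun _ => (-q - 1 : ℤ))]; congr 1; ext; simp [add_assoc]

theorem IsCylindricBHZ.add {α : ZMod n → ℝ} {τ : (ZMod n → ℤ) → ℝ} (hτ : IsCylindricBHZ α τ)
    (m : ZMod n → ℤ) : IsCylindricBHZ α fun s => τ (s + m) := by
  refine ⟨fun s i j k hij hjk hik => ?_, fun s => ?_⟩
  · have := hτ.1 (s + m) i j k hij hjk hik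
    simp only [add_right_comm s m, add_right_comm _ m] at this
    exact this
  · simp only [add_right_comm s 1 m, hτ.2]

/-- The parameters `a, b, c` and `a', b', c'` on the two sides of a braid move satisfy
`b' = a + c`, `a' b' = b c` and `b' c' = a b`.  The first equation is the three-term relation of `τ`,
the others hold for every `τ`. -/
theorem cellParam_braid {α : ZMod n → ℝ} {τ : (ZMod n → ℤ) → ℝ} (hτ : IsBHZ α τ)
    (h0 : ∀ s, 0 < τ s) (s : ZMod n → ℤ) {x y z : ZMod n} (hxy : x ≠ y) (hyz : y ≠ z)
    (hxz : x ≠ z) :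
    cellParam α τ s x z = cellParam α τ s x y + cellParam α τ s y z ∧
      cellParam α τ (s + stdVec x) y z * cellParam α τ s x z =
        cellParam α τ (s + stdVec y) x z * cellParam α τ s y z ∧
      cellParam α τ s x z * cellParam α τ (s + stdVec z) x y =
        cellParam α τ s x y * cellParam α τ (s + stdVec y) x z := by
  have hb := hτ s x y z hxy hyz hxz
  have n0 := (h0 s).ne'
  have nx := (h0 (s + stdVec x)).ne'
  have ny := (h0 (s + stdVec y)).ne'
  have nz := (h0 (s + stdVec z)).ne'
  have nxy := (h0 (s + stdVec x + stdVec y)).ne'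
  have nxz := (h0 (s + stdVec x + stdVec z)).ne'
  have nyz := (h0 (s + stdVec y + stdVec z)).ne'
  simp only [cellParam]
  rw [add_right_comm s (stdVec z) (stdVec x), add_right_comm s (stdVec y) (stdVec x),
    add_right_comm s (stdVec z) (stdVec y),
    show s + stdVec x + stdVec z + stdVec y = s + stdVec x + stdVec y + stdVec z by abel,
    show s + stdVec y + stdVec z + stdVec x = s + stdVec x + stdVec y + stdVec z by abel]
  refine ⟨?_, ?_, ?_⟩
  · field_simp
    linear_combination hb
  · field_simp
  · field_simp

theorem length_rot (k : ZMod n) (ω : List (ZMod n)) : (rot k ω).length = ω.length := by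
  simp [rot]

variable [Fact (3 ≤ n)]

theorem tauParam_eq_crossParam (α : ZMod n → ℝ) (τ : (ZMod n → ℤ) → ℝ) (g : Equiv.Perm ℤ)
    (ω : List (ZMod n)) (p : Fin ω.length) :
    tauParam α τ g ω p = crossParam α τ (wiringAt g ω p) (crossPos ω p) := rfl

theorem crossParam_congr (α : ZMod n → ℝ) {τ : (ZMod n → ℤ) → ℝ} (hτ : ∀ s, τ (s + 1) = τ s)
    {W : Equiv.Perm ℤ} (hW : W ∈ periodicPerms n) {c c' : ℤ} (h : (c : ZMod n) = c') :
    crossParam α τ W c = crossParam α τ W c' := by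
  obtain ⟨q, rfl⟩ := exists_add_mul_of_cast_eq h
  rw [crossParam, crossParam, show c + n * q - 1 = c - 1 + n * q by ring, wiringVec_add_mul hW,
    cellParam_add, show c + n * q + 1 = c + 1 + n * q by ring, periodicPerms_add_mul hW,
    periodicPerms_add_mul hW]
  simp only [apply_add_const hτ]
  simp

theorem crossParam_transl_mul_mul_addRight (α : ZMod n → ℝ) (τ : (ZMod n → ℤ) → ℝ)
    {W : Equiv.Perm ℤ} (hW : W ∈ periodicPerms n) (m : ZMod n → ℤ) (r c : ℤ) :
    crossParam α τ (transl m * W * Equiv.addRight (-r)) (c + r) =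
      crossParam α (fun s => τ (s + m)) W c := by
  rw [crossParam, crossParam, wiringVec_mul_addRight, wiringVec_transl_mul hW, cellParam_add,
    show c + r - 1 + -r = c - 1 by ring]
  simp only [Equiv.Perm.mul_apply, Equiv.coe_addRight, cast_transl]
  rw [show c + r + -r = c by ring, show c + r + 1 + -r = c + 1 by ring]

theorem wiringAt_rot (g : Equiv.Perm ℤ) (m : ZMod n → ℤ) (r : ℤ) (ω : List (ZMod n))
    (p : Fin ω.length) :
    wiringAt (transl m * g * Equiv.addRight (-r)) (rot (r : ZMod n) ω)
      (Fin.cast (length_rot _ _).symm p) = transl m * wiringAt g ω p * Equiv.addRight (-r) := by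
  have : (rot (r : ZMod n) ω).take p = rot (r : ZMod n) (ω.take p) := by simp [rot]
  rw [wiringAt, Fin.val_cast, this, wordPerm_rot, wiringAt, ← addRight_inv]
  group

/-- Rotating a word and its wiring, and translating the wires, amounts to a shift of `τ`. -/
theorem tauParam_rot (α : ZMod n → ℝ) {τ : (ZMod n → ℤ) → ℝ} (hτ : ∀ s, τ (s + 1) = τ s)
    {g : Equiv.Perm ℤ} (hg : g ∈ periodicPerms n) (m : ZMod n → ℤ) (r : ℤ) (ω : List (ZMod n))
    (p : Fin ω.length) :
    tauParam α τ (transl m * g * Equiv.addRight (-r)) (rot (r : ZMod n) ω)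
      (Fin.cast (length_rot _ _).symm p) = tauParam α (fun s => τ (s + m)) g ω p := by
  have hW := wiringAt_mem_periodicPerms hg ω p
  rw [tauParam_eq_crossParam, wiringAt_rot, tauParam_eq_crossParam,
    ← crossParam_transl_mul_mul_addRight α τ hW m r]
  refine crossParam_congr α hτ (mul_mem (mul_mem (transl_mem_periodicPerms m) hW)
    (addRight_mem_periodicPerms _)) ?_
  push_cast
  rw [cast_crossPos, cast_crossPos]
  simp only [rot, List.get_eq_getElem, List.getElem_map]
  rfl

end CrossParam

section Decorate

variable {n : ℕ}

theorem LusztigMove.pos {X Y : List (ZMod n × ℝ)} (h : LusztigMove X Y)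
    (hX : ∀ x ∈ X, 0 < x.2) : ∀ x ∈ Y, 0 < x.2 := by
  cases h with
  | braid L R i j a b c hij ha hb hc =>
    intro x hx
    simp only [List.append_assoc, List.cons_append, List.nil_append, List.mem_append,
      List.mem_cons] at hx hX
    rcases hx with hx | rfl | rfl | rfl | hx
    · exact hX x (by simp [hx])
    · dsimp only; positivity
    · dsimp only; positivity
    · dsimp only; positivity
    · exact hX x (by simp [hx])
  | comm L R i j a b h0 h1 h2 =>
    intro x hx
    refine hX x ?_
    simp only [List.append_assoc, List.cons_append, List.nil_append, List.mem_append,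
      List.mem_cons] at hx ⊢
    tauto

theorem weighted_rot (k : ZMod n) (ω : List (ZMod n)) (y : Fin (rot k ω).length → ℝ) :
    weighted k ω (fun p => y (Fin.cast (length_rot _ _).symm p)) = weighted 0 (rot k ω) y := by
  refine List.ext_getElem (by simp [weighted, rot]) fun p h1 h2 => ?_
  simp only [weighted, List.getElem_ofFn, add_zero, List.get_eq_getElem]
  simp only [rot, List.getElem_map]
  rfl

variable [Fact (3 ≤ n)]

/-- The weighted word of a wiring diagram, whose weights are a function of the wiring to the left
of each letter and of the letter. -/
def decorate (F : Equiv.Perm ℤ → ZMod n → ℝ) : Equiv.Perm ℤ → List (ZMod n) → List (ZMod n × ℝ)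
  | _, [] => []
  | g, i :: ω => (i, F g i) :: decorate F (g * simplePerm i) ω

theorem decorate_append (F : Equiv.Perm ℤ → ZMod n → ℝ) (g : Equiv.Perm ℤ)
    (ω ω' : List (ZMod n)) :
    decorate F g (ω ++ ω') = decorate F g ω ++ decorate F (g * wordPerm ω) ω' := by
  induction ω generalizing g with
  | nil => simp [decorate, wordPerm_nil]
  | cons i ω ih => simp [decorate, ih, wordPerm_cons, mul_assoc]

theorem length_decorate (F : Equiv.Perm ℤ → ZMod n → ℝ) (g : Equiv.Perm ℤ) (ω : List (ZMod n)) :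
    (decorate F g ω).length = ω.length := by
  induction ω generalizing g with
  | nil => rfl
  | cons i ω ih => simp [decorate, ih]

theorem getElem_decorate (F : Equiv.Perm ℤ → ZMod n → ℝ) (g : Equiv.Perm ℤ) (ω : List (ZMod n))
    (p : ℕ) (hp : p < ω.length) :
    (decorate F g ω)[p]'(by rwa [length_decorate]) =
      (ω[p], F (g * wordPerm (ω.take p)) ω[p]) := by
  induction ω generalizing g p with
  | nil => simp at hp
  | cons i ω ih =>
    cases p with
    | zero => simp [decorate, wordPerm_nil]
    | succ p =>
      have := ih (g * simplePerm i) p (by simpa using hp)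
      simpa [decorate, wordPerm_cons, mul_assoc] using this

/-- The weights given by the `τ`-function. -/
noncomputable def tauWeight (α : ZMod n → ℝ) (τ : (ZMod n → ℤ) → ℝ) (W : Equiv.Perm ℤ)
    (i : ZMod n) : ℝ :=
  crossParam α τ W (i.val : ℤ)

theorem tauWeight_eq (α : ZMod n → ℝ) {τ : (ZMod n → ℤ) → ℝ} (hτ : ∀ s, τ (s + 1) = τ s)
    {W : Equiv.Perm ℤ} (hW : W ∈ periodicPerms n) {c : ℤ} {i : ZMod n} (h : (c : ZMod n) = i) :
    tauWeight α τ W i = crossParam α τ W c :=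
  crossParam_congr α hτ hW (by simp [h])

theorem weighted_tauParam (α : ZMod n → ℝ) (τ : (ZMod n → ℤ) → ℝ) (g : Equiv.Perm ℤ)
    (ω : List (ZMod n)) :
    weighted 0 ω (tauParam α τ g ω) = decorate (tauWeight α τ) g ω := by
  refine List.ext_getElem (by simp [weighted, length_decorate]) fun p h1 h2 => ?_
  rw [getElem_decorate _ _ _ _ (by simpa [length_decorate] using h2)]
  simp only [weighted, List.getElem_ofFn, add_zero]
  rfl

/-- A non-neighbouring crossing does not affect the weight. -/
theorem tauWeight_mul_simplePerm (α : ZMod n → ℝ) (τ : (ZMod n → ℤ) → ℝ) (W : Equiv.Perm ℤ)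
    {i j : ZMod n} (h0 : i ≠ j) (h1 : i - j ≠ 1) (h2 : j - i ≠ 1) :
    tauWeight α τ (W * simplePerm i) j = tauWeight α τ W j := by
  have hc : ((j.val : ℤ) : ZMod n) = j := by simp
  have e1 : i ≠ j + 1 := fun h => h1 (by rw [h]; ring)
  have e2 : j ≠ i + 1 := fun h => h2 (by rw [h]; ring)
  have e3 : j - 1 ≠ i := fun h => h2 (by rw [← h]; ring)
  have e4 : j + 1 ≠ i + 1 := fun h => h0 (by simpa using h.symm)
  rw [tauWeight, tauWeight, crossParam, crossParam,
    wiringVec_mul_simplePerm W (by push_cast; simpa),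
    Equiv.Perm.mul_apply, Equiv.Perm.mul_apply, simplePerm_of_ne (by rw [hc]; exact h0.symm)
    (by rwa [hc]), simplePerm_of_ne (by push_cast; simpa using e1.symm)
    (by push_cast; simpa using e4)]

/-- The weights on both sides of a braid move, in terms of the three wires `x`, `y`, `z` that cross
and of the chamber below them. -/
theorem tauWeight_braid (α : ZMod n → ℝ) {τ : (ZMod n → ℤ) → ℝ} (hτ : ∀ s, τ (s + 1) = τ s)
    {W : Equiv.Perm ℤ} (hW : W ∈ periodicPerms n) (i : ZMod n) :
    ∃ (s : ZMod n → ℤ) (x y z : ZMod n), x ≠ y ∧ y ≠ z ∧ x ≠ z ∧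
      tauWeight α τ W i = cellParam α τ s x y ∧
      tauWeight α τ (W * simplePerm i) (i + 1) = cellParam α τ (s + stdVec y) x z ∧
      tauWeight α τ (W * simplePerm i * simplePerm (i + 1)) i = cellParam α τ s y z ∧
      tauWeight α τ W (i + 1) = cellParam α τ (s + stdVec x) y z ∧
      tauWeight α τ (W * simplePerm (i + 1)) i = cellParam α τ s x z ∧
      tauWeight α τ (W * simplePerm (i + 1) * simplePerm i) (i + 1) =
        cellParam α τ (s + stdVec z) x y := by
  have hs := @simplePerm_mem_periodicPerms n _
  have h1 := zmodOneNeZero n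
  have h2 := zmodTwoNeZero n
  have hc : ((i.val : ℤ) : ZMod n) = i := by simp
  set c : ℤ := (i.val : ℤ)
  have hc1 : ((c + 1 : ℤ) : ZMod n) = i + 1 := by push_cast; rw [hc]
  have n1 : ((c - 1 : ℤ) : ZMod n) ≠ i := by push_cast; rw [hc]; simpa using h1
  have n2 : ((c - 1 : ℤ) : ZMod n) ≠ i + 1 := by
    push_cast; rw [hc]
    intro h
    exact h2 (by linear_combination -h)
  obtain ⟨⟨k1, k2, k3⟩, k4, k5, k6⟩ := simplePerm_neighbours hc
  have e2 : c + 1 + 1 = c + 2 := by ring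
  have e0 : c + 1 - 1 = c := by ring
  have e : c - 1 + 1 = c := by ring
  have hne {a b : ℤ} (h : (a : ZMod n) ≠ b) : ((W a : ℤ) : ZMod n) ≠ ((W b : ℤ) : ZMod n) :=
    fun h' => h (periodicPerms_cast_inj hW h')
  refine ⟨wiringVec n W (c - 1), (W c : ℤ), (W (c + 1) : ℤ), (W (c + 2) : ℤ), hne ?_, hne ?_,
    hne ?_, ?_, ?_, ?_, ?_, ?_, ?_⟩
  · push_cast; simpa using h1
  · push_cast; simp only [ne_eq, add_right_inj]; intro h; exact h1 (by linear_combination -h)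
  · push_cast; simpa using h2
  · rw [tauWeight_eq α hτ hW hc, crossParam]
  · rw [tauWeight_eq α hτ (mul_mem hW (hs _)) hc1, crossParam, e0, e2,
      wiringVec_step (mul_mem hW (hs _)) e, wiringVec_mul_simplePerm W n1]
    simp only [Equiv.Perm.mul_apply, k1, k2, k3]
  · rw [tauWeight_eq α hτ (mul_mem (mul_mem hW (hs _)) (hs _)) hc, crossParam,
      wiringVec_mul_simplePerm _ n2, wiringVec_mul_simplePerm _ n1]
    simp only [Equiv.Perm.mul_apply, k1, k3, k4, k5]
  · rw [tauWeight_eq α hτ hW hc1, crossParam, e0, e2, wiringVec_step hW e]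
  · rw [tauWeight_eq α hτ (mul_mem hW (hs _)) hc, crossParam, wiringVec_mul_simplePerm _ n2]
    simp only [Equiv.Perm.mul_apply, k4, k5]
  · rw [tauWeight_eq α hτ (mul_mem (mul_mem hW (hs _)) (hs _)) hc1, crossParam, e0, e2,
      wiringVec_step (mul_mem (mul_mem hW (hs _)) (hs _)) e, wiringVec_mul_simplePerm _ n1,
      wiringVec_mul_simplePerm _ n2]
    simp only [Equiv.Perm.mul_apply, k1, k2, k3, k4, k5, k6]

/-- A braid move with positive weights transforms them as in Lusztig's relation. -/
theorem tauWeight_braid_move {α : ZMod n → ℝ} {τ : (ZMod n → ℤ) → ℝ} (hτ : IsCylindricBHZ α τ)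
    (h0 : ∀ s, 0 < τ s) {W : Equiv.Perm ℤ} (hW : W ∈ periodicPerms n) {i j : ZMod n}
    (hij : i - j = 1 ∨ j - i = 1) {a b c : ℝ} (ha : a = tauWeight α τ W i)
    (hb : b = tauWeight α τ (W * simplePerm i) j)
    (hc : c = tauWeight α τ (W * simplePerm i * simplePerm j) i)
    (a0 : 0 < a) (b0 : 0 < b) (c0 : 0 < c) :
    tauWeight α τ W j = b * c / (a + c) ∧ tauWeight α τ (W * simplePerm j) i = a + c ∧
      tauWeight α τ (W * simplePerm j * simplePerm i) j = a * b / (a + c) := by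
  subst ha hb hc
  rcases hij with h | h
  · obtain rfl : i = j + 1 := by rw [← h]; ring
    obtain ⟨s, x, y, z, hxy, hyz, hxz, e1, e2, e3, e4, e5, e6⟩ := tauWeight_braid α hτ.2 hW j
    obtain ⟨r1, r2, r3⟩ := cellParam_braid hτ.1 h0 s hxy hyz hxz
    rw [e4] at a0
    rw [e5] at b0
    rw [e6] at c0
    rw [e1, e2, e3, e4, e5, e6]
    -- the middle weight on one side is the sum of the outer weights on the other side
    have r4 : cellParam α τ (s + stdVec y) x z =
        cellParam α τ (s + stdVec x) y z + cellParam α τ (s + stdVec z) x y := by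
      refine mul_left_cancel₀ b0.ne' ?_
      linear_combination cellParam α τ (s + stdVec y) x z * r1 - r2 - r3
    refine ⟨?_, r4, ?_⟩
    · rw [eq_div_iff (by positivity), ← r4, r3]
    · rw [eq_div_iff (by positivity), ← r4, r2, mul_comm]
  · obtain rfl : j = i + 1 := by rw [← h]; ring
    obtain ⟨s, x, y, z, hxy, hyz, hxz, e1, e2, e3, e4, e5, e6⟩ := tauWeight_braid α hτ.2 hW i
    obtain ⟨r1, r2, r3⟩ := cellParam_braid hτ.1 h0 s hxy hyz hxz
    rw [e1] at a0
    rw [e3] at c0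
    rw [e1, e2, e3, e4, e5, e6]
    refine ⟨?_, r1, ?_⟩
    · rw [eq_div_iff (by positivity), ← r1, r2]
    · rw [eq_div_iff (by positivity), ← r1, ← r3, mul_comm]

/-- The Berenstein–Hirota–Zelevinsky relations turn braid moves into Lusztig's relations. -/
theorem BraidMove.lusztigMove {α : ZMod n → ℝ} {τ : (ZMod n → ℤ) → ℝ} (hτ : IsCylindricBHZ α τ)
    (h0 : ∀ s, 0 < τ s) {g : Equiv.Perm ℤ} (hg : g ∈ periodicPerms n) {ω ω' : List (ZMod n)}
    (h : BraidMove ω ω') (hpos : ∀ x ∈ decorate (tauWeight α τ) g ω, 0 < x.2) :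
    LusztigMove (decorate (tauWeight α τ) g ω) (decorate (tauWeight α τ) g ω') := by
  have hw := h.wordPerm_eq
  cases h with
  | braid L R i j hij =>
    have hW : g * wordPerm L ∈ periodicPerms n := mul_mem hg (wordPerm_mem_periodicPerms L)
    rw [decorate_append, decorate_append] at hpos ⊢
    rw [decorate_append _ _ (L ++ _), decorate_append _ _ L]
    have hw' : wordPerm (L ++ [j, i, j]) = wordPerm (L ++ [i, j, i]) := by
      rw [wordPerm_append (L ++ _), wordPerm_append (L ++ _), mul_left_inj] at hw
      exact hw.symm
    rw [hw']
    set W := g * wordPerm L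
    have hexp : ∀ i j : ZMod n, decorate (tauWeight α τ) W [i, j, i] =
      [(i, tauWeight α τ W i), (j, tauWeight α τ (W * simplePerm i) j),
        (i, tauWeight α τ (W * simplePerm i * simplePerm j) i)] := fun _ _ => rfl
    rw [hexp] at hpos ⊢
    rw [hexp]
    have p1 := hpos (i, tauWeight α τ W i) (by simp)
    have p2 := hpos (j, tauWeight α τ (W * simplePerm i) j) (by simp)
    have p3 := hpos (i, tauWeight α τ (W * simplePerm i * simplePerm j) i) (by simp)
    dsimp only at p1 p2 p3
    obtain ⟨q1, q2, q3⟩ := tauWeight_braid_move hτ h0 hW hij rfl rfl rfl p1 p2 p3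
    rw [q1, q2, q3]
    exact LusztigMove.braid _ _ i j _ _ _ hij p1 p2 p3
  | comm L R i j h1 h2 h3 =>
    rw [decorate_append, decorate_append]
    rw [decorate_append _ _ (L ++ _), decorate_append _ _ L]
    have hw' : wordPerm (L ++ [j, i]) = wordPerm (L ++ [i, j]) := by
      rw [wordPerm_append (L ++ _), wordPerm_append (L ++ _), mul_left_inj] at hw
      exact hw.symm
    rw [hw']
    have hexp : ∀ (W : Equiv.Perm ℤ) (i j : ZMod n), decorate (tauWeight α τ) W [i, j] =
      [(i, tauWeight α τ W i), (j, tauWeight α τ (W * simplePerm i) j)] := fun _ _ _ => rfl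
    rw [hexp, hexp, tauWeight_mul_simplePerm α τ _ h1 h2 h3,
      tauWeight_mul_simplePerm α τ _ h1.symm h3 h2]
    exact LusztigMove.comm _ _ i j _ _ h1 h2 h3

end Decorate

/-! ### The wiring of affine dKdV -/

namespace AffineDKdV

variable {n : ℕ} [Fact (3 ≤ n)] (P : AffineDKdV n)

theorem weights_lt_state (p : Fin P.u.length) :
    P.α (lowerWire 1 P.u p) < P.α (upperWire 1 P.u p) := by
  have hp : P.v.length + p < (P.v ++ P.u).length := by simp
  have hW : wiringAt (wordPerm P.v)⁻¹ (P.v ++ P.u) ⟨P.v.length + p, hp⟩ = wiringAt 1 P.u p := by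
    rw [wiringAt, wiringAt, show (P.v ++ P.u).take (P.v.length + p) = P.v ++ P.u.take p by
        simp [List.take_append, List.take_of_length_le (Nat.le_add_right P.v.length p)],
      wordPerm_append, inv_mul_cancel_left, one_mul]
  have hc : crossPos (P.v ++ P.u) ⟨P.v.length + p, hp⟩ = crossPos P.u p := by
    simp [crossPos, List.getElem_append_right]
  refine P.α_lt _ _ ⟨⟨P.v.length + p, hp⟩, ?_, ?_⟩
  · rw [lowerWire, lowerWire, hW, hc]
  · rw [upperWire, upperWire, hW, hc]

theorem weights_lt_carrier (p : Fin P.v.length) :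
    P.α (lowerWire (wordPerm P.v)⁻¹ P.v p) < P.α (upperWire (wordPerm P.v)⁻¹ P.v p) := by
  have hp : (p : ℕ) < (P.v ++ P.u).length := by simp; omega
  have hW : wiringAt (wordPerm P.v)⁻¹ (P.v ++ P.u) ⟨p, hp⟩ =
      wiringAt (wordPerm P.v)⁻¹ P.v p := by
    simp [wiringAt, List.take_append, Nat.sub_eq_zero_of_le p.2.le]
  have hc : crossPos (P.v ++ P.u) ⟨p, hp⟩ = crossPos P.v p := by
    simp [crossPos, List.getElem_append_left]
  refine P.α_lt _ _ ⟨⟨p, hp⟩, ?_, ?_⟩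
  · rw [lowerWire, lowerWire, hW, hc]
  · rw [upperWire, upperWire, hW, hc]

/-- The offset of the state word, as an integer. -/
def stateShift : ℤ := ((offset P.u).val : ℤ)

/-- The offset of the carrier word, as an integer. -/
def carrierShift : ℤ := ((offset P.v).val : ℤ)

theorem cast_stateShift : (P.stateShift : ZMod n) = offset P.u := by simp [stateShift]

theorem cast_carrierShift : (P.carrierShift : ZMod n) = offset P.v := by simp [carrierShift]

theorem exists_stateVec :
    ∃ μ : ZMod n → ℤ, wordPerm P.u = transl μ * Equiv.addRight P.stateShift :=
  exists_eq_transl_mul_addRight (wordPerm_mem_periodicPerms _) _ fun a => by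
    rw [cast_wordPerm, P.u_glide, cast_stateShift]

theorem exists_carrierVec :
    ∃ μ : ZMod n → ℤ, wordPerm P.v = Equiv.addRight P.carrierShift * transl μ := by
  obtain ⟨μ, hμ⟩ := exists_eq_transl_mul_addRight (wordPerm_mem_periodicPerms P.v)
    P.carrierShift fun a => by rw [cast_wordPerm, P.v_glide, cast_carrierShift]
  exact ⟨_, hμ.trans (transl_mul_addRight _ _)⟩

/-- The state word is the glide `transl stateVec * addRight stateShift`. -/
noncomputable def stateVec : ZMod n → ℤ := P.exists_stateVec.choose

/-- The carrier word is the glide `addRight carrierShift * transl carrierVec`. -/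
noncomputable def carrierVec : ZMod n → ℤ := P.exists_carrierVec.choose

theorem wordPerm_u : wordPerm P.u = transl P.stateVec * Equiv.addRight P.stateShift :=
  P.exists_stateVec.choose_spec

theorem wordPerm_v : wordPerm P.v = Equiv.addRight P.carrierShift * transl P.carrierVec :=
  P.exists_carrierVec.choose_spec

theorem wordPerm_v_inv :
    (wordPerm P.v)⁻¹ = transl (-P.carrierVec) * Equiv.addRight (-P.carrierShift) := by
  rw [wordPerm_v, mul_inv_rev, transl_inv, addRight_inv]

/-- Wires that move faster downwards through the state word have larger weights. -/
theorem α_lt_of_stateVec_lt {x y : ZMod n} (h : P.stateVec x < P.stateVec y) :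
    P.α x < P.α y := by
  have hn : 3 ≤ (n : ℤ) := by exact_mod_cast (Fact.out : 3 ≤ n)
  have hxy : x ≠ y := by rintro rfl; exact lt_irrefl _ h
  obtain ⟨a, b, ha, hb, hab, hba⟩ : ∃ a b : ℤ, (a : ZMod n) = x ∧ (b : ZMod n) = y ∧ a < b ∧
      b < a + n := by
    have hx := ZMod.val_lt x
    have hy := ZMod.val_lt y
    have hne : x.val ≠ y.val := fun h => hxy (ZMod.val_injective n h)
    rcases hne.lt_or_gt with h | h
    · exact ⟨x.val, y.val, by simp, by simp, by omega, by omega⟩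
    · exact ⟨x.val, y.val + n, by simp, by simp, by omega, by omega⟩
  have hinv (c : ℤ) : (wordPerm P.u)⁻¹ c = c - n * P.stateVec c - P.stateShift := by
    rw [wordPerm_u, mul_inv_rev, transl_inv, addRight_inv, Equiv.Perm.mul_apply, transl_apply]
    simp [sub_eq_add_neg]
  obtain ⟨p, hp₁, hp₂⟩ := exists_crossing_of_inversion (one_mem (periodicPerms n)) P.u hab (by
    rw [hinv, hinv, ha, hb]
    have : (n : ℤ) * (P.stateVec x + 1) ≤ n * P.stateVec y := by gcongr; omega
    linarith)
  have := P.weights_lt_state p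
  rwa [hp₁, hp₂, Equiv.Perm.one_apply, Equiv.Perm.one_apply, ha, hb] at this

/-- Some wires cross in the state word, so they move at different speeds. -/
theorem exists_stateVec_lt (hu : P.u ≠ []) : ∃ x y, P.stateVec x < P.stateVec y := by
  by_contra hc
  push Not at hc
  have hconst (x y : ZMod n) : P.stateVec x = P.stateVec y := le_antisymm (hc y x) (hc x y)
  obtain ⟨ω, i, hω⟩ := (List.eq_nil_or_concat P.u).resolve_left hu
  rw [List.concat_eq_append] at hω
  have hasc := isAscending_of_weights (one_mem (periodicPerms n)) P.α P.weights_lt_state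
  rw [hω] at hasc
  refine not_isAscent_of_isAscending (isAscending_concat.1 hasc).2 fun a _ => ?_
  rw [← hω, wordPerm_u, Equiv.Perm.mul_apply, Equiv.Perm.mul_apply, transl_apply, transl_apply,
    hconst ((Equiv.addRight P.stateShift a : ℤ) : ZMod n) 0,
    hconst ((Equiv.addRight P.stateShift (a + 1) : ℤ) : ZMod n) 0]
  simp

theorem exists_α_lt (hu : P.u ≠ []) : ∃ x y, P.α x < P.α y := by
  obtain ⟨x, y, h⟩ := P.exists_stateVec_lt hu
  exact ⟨x, y, P.α_lt_of_stateVec_lt h⟩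

/-- The wiring to the left of block `i` at time `t`. -/
noncomputable def wiring (t i : ℤ) : Equiv.Perm ℤ :=
  transl (i • P.stateVec - t • P.carrierVec) *
    Equiv.addRight (i * P.stateShift - t * P.carrierShift)

/-- A lift of the rotation of block `i` at time `t`. -/
noncomputable def rotationLift (t i : ℤ) : ℤ := -i * P.stateShift + t * P.carrierShift

theorem cast_rotationLift (t i : ℤ) : (P.rotationLift t i : ZMod n) = P.rotation t i := by
  simp [rotationLift, rotation, cast_stateShift, cast_carrierShift]

theorem wiring_eq (t i : ℤ) : P.wiring t i =
    transl (i • P.stateVec - t • P.carrierVec) * 1 * Equiv.addRight (-P.rotationLift t i) := by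
  rw [wiring, mul_one, rotationLift]
  congr 2
  ring

theorem wiring_succ_eq (t i : ℤ) : P.wiring (t + 1) i =
    transl (i • P.stateVec - t • P.carrierVec) * (wordPerm P.v)⁻¹ *
      Equiv.addRight (-P.rotationLift t i) := by
  rw [wiring, wordPerm_v_inv, ← mul_assoc, transl_mul, mul_assoc, addRight_mul, rotationLift]
  congr 2
  · rw [add_smul, one_smul]; abel
  · ring

theorem isWiring_wiring : P.IsWiring P.wiring where
  base := by
    rw [wiring]
    simp [transl_zero]
  state t i := by
    rw [wiring_eq P t i, ← cast_rotationLift, wordPerm_rot, wordPerm_u, wiring, ← addRight_inv,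
      mul_one]
    simp only [mul_assoc, inv_mul_cancel_left]
    rw [addRight_inv, addRight_mul, ← mul_assoc, transl_mul, rotationLift]
    congr 2
    · rw [add_smul, one_smul]; abel
    · ring
  carrier t i := by
    rw [wiring_succ_eq, ← cast_rotationLift, wordPerm_rot, wiring_eq, ← addRight_inv]
    group

/-- The wirings on both sides of the exchange of the state word and the carrier word agree. -/
theorem wordPerm_exchange :
    wordPerm (P.v ++ P.u) = wordPerm (rot (offset P.v) P.u ++ rot (-offset P.u) P.v) := by
  have h1 : -offset P.u = ((-P.stateShift : ℤ) : ZMod n) := by push_cast; rw [cast_stateShift]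
  rw [h1, ← cast_carrierShift, wordPerm_append, wordPerm_append, wordPerm_rot, wordPerm_rot,
    wordPerm_u, wordPerm_v, neg_neg]
  have e1 : Equiv.addRight P.carrierShift * (transl P.stateVec * Equiv.addRight P.stateShift) *
      Equiv.addRight (-P.carrierShift) * (Equiv.addRight (-P.stateShift) *
        (Equiv.addRight P.carrierShift * transl P.carrierVec) * Equiv.addRight P.stateShift) =
      Equiv.addRight P.carrierShift * (transl P.stateVec * (Equiv.addRight P.stateShift *
      Equiv.addRight (-P.carrierShift) * Equiv.addRight (-P.stateShift) *
        Equiv.addRight P.carrierShift) * transl P.carrierVec) * Equiv.addRight P.stateShift := by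
    group
  have e2 : Equiv.addRight P.stateShift * Equiv.addRight (-P.carrierShift) *
      Equiv.addRight (-P.stateShift) * Equiv.addRight P.carrierShift = 1 := by
    rw [addRight_mul, addRight_mul, addRight_mul]
    ext a
    simp
  rw [e1, e2, mul_one, transl_mul, add_comm, ← transl_mul]
  group

theorem braidEquiv_exchange :
    BraidEquiv (P.v ++ P.u) (rot (offset P.v) P.u ++ rot (-offset P.u) P.v) := by
  refine braidEquiv_of_wordPerm_eq ?_ P.wordPerm_exchange (by simp [length_rot, add_comm])
  exact isAscending_of_weights (inv_mem (wordPerm_mem_periodicPerms P.v)) P.α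
    fun p => P.α_lt _ _ ⟨p, rfl, rfl⟩

theorem tauParam_pos {α : ZMod n → ℝ} {τ : (ZMod n → ℤ) → ℝ} (h0 : ∀ s, 0 < τ s)
    {g : Equiv.Perm ℤ} {ω : List (ZMod n)} {p : Fin ω.length}
    (h : α (lowerWire g ω p) < α (upperWire g ω p)) : 0 < tauParam α τ g ω p := by
  have := sub_pos.2 h
  have := h0
  unfold tauParam
  exact div_pos (mul_pos (by assumption) (mul_pos (h0 _) (h0 _))) (mul_pos (h0 _) (h0 _))

/-- The form of `tauParam_rot` for all letters of a word at once. -/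
theorem tauParam_rot_eq {k : ZMod n} {r : ℤ} (hr : (r : ZMod n) = k) {α : ZMod n → ℝ}
    {τ : (ZMod n → ℤ) → ℝ} (hτ : ∀ s, τ (s + 1) = τ s) {g W : Equiv.Perm ℤ}
    (hg : g ∈ periodicPerms n) {m : ZMod n → ℤ} (hW : W = transl m * g * Equiv.addRight (-r))
    (ω : List (ZMod n)) :
    (fun p => tauParam α τ W (rot k ω) (Fin.cast (length_rot _ _).symm p)) =
      tauParam α (fun s => τ (s + m)) g ω := by
  subst hr hW
  exact funext fun p => tauParam_rot α hτ hg m r ω p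

/-- The exchange of the state word and the carrier word, with weights given by a `τ`-function. -/
theorem interacts_tauParam {τ : (ZMod n → ℤ) → ℝ} (hτ : IsCylindricBHZ P.α τ)
    (h0 : ∀ s, 0 < τ s) :
    Interacts P.u P.v (tauParam P.α τ (wordPerm P.v)⁻¹ P.v) (tauParam P.α τ 1 P.u)
      (tauParam P.α (fun s => τ (s + -P.carrierVec)) 1 P.u)
      (tauParam P.α (fun s => τ (s + P.stateVec)) (wordPerm P.v)⁻¹ P.v) := by
  have hv := inv_mem (wordPerm_mem_periodicPerms P.v)
  have h1 := tauParam_rot_eq P.cast_carrierShift (α := P.α) hτ.2 (one_mem (periodicPerms n))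
    (m := -P.carrierVec) (W := (wordPerm P.v)⁻¹) (by rw [mul_one, wordPerm_v_inv]) P.u
  have h2 := tauParam_rot_eq (k := -offset P.u) (r := -P.stateShift)
    (by push_cast; rw [cast_stateShift]) (α := P.α) hτ.2 hv (m := P.stateVec)
    (W := (wordPerm P.v)⁻¹ * wordPerm (rot (offset P.v) P.u)) (by
      rw [← cast_carrierShift, wordPerm_rot, wordPerm_v_inv, wordPerm_u, ← addRight_inv]
      simp only [mul_assoc, inv_mul_cancel_left]
      rw [addRight_inv, ← mul_assoc, transl_mul, addRight_mul, addRight_mul, ← mul_assoc,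
        transl_mul]
      congr 2
      · abel
      · ring) P.v
  unfold Interacts
  rw [← h1, ← h2, weighted_rot, weighted_rot, weighted_tauParam, weighted_tauParam,
    weighted_tauParam, weighted_tauParam, ← decorate_append,
    show (1 : Equiv.Perm ℤ) = (wordPerm P.v)⁻¹ * wordPerm P.v by simp, ← decorate_append]
  have hpos : ∀ x ∈ decorate (tauWeight P.α τ) (wordPerm P.v)⁻¹ (P.v ++ P.u), 0 < x.2 := by
    rw [← weighted_tauParam]
    intro x hx
    obtain ⟨p, rfl⟩ := List.mem_ofFn.1 hx
    exact tauParam_pos h0 (P.α_lt _ _ ⟨p, rfl, rfl⟩)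
  have key : ∀ ω, BraidEquiv (P.v ++ P.u) ω →
      Relation.ReflTransGen LusztigMove
        (decorate (tauWeight P.α τ) (wordPerm P.v)⁻¹ (P.v ++ P.u))
        (decorate (tauWeight P.α τ) (wordPerm P.v)⁻¹ ω) ∧
      ∀ x ∈ decorate (tauWeight P.α τ) (wordPerm P.v)⁻¹ ω, 0 < x.2 := by
    intro ω h
    induction h with
    | refl => exact ⟨.refl, hpos⟩
    | tail _ h ih =>
      have := h.lusztigMove hτ h0 hv ih.2
      exact ⟨ih.1.tail this, this.pos ih.2⟩
  exact (key _ P.braidEquiv_exchange).1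

theorem tauState_wiring {τ : (ZMod n → ℤ) → ℝ} (hτ : IsCylindricBHZ P.α τ) (t i : ℤ) :
    P.tauState P.wiring τ t i =
      tauParam P.α (fun s => τ (s + (i • P.stateVec - t • P.carrierVec))) 1 P.u :=
  tauParam_rot_eq (P.cast_rotationLift t i) hτ.2 (one_mem _) (P.wiring_eq t i) P.u

theorem tauCarrier_wiring {τ : (ZMod n → ℤ) → ℝ} (hτ : IsCylindricBHZ P.α τ) (t i : ℤ) :
    P.tauCarrier P.wiring τ t i =
      tauParam P.α (fun s => τ (s + (i • P.stateVec - t • P.carrierVec))) (wordPerm P.v)⁻¹ P.v :=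
  tauParam_rot_eq (P.cast_rotationLift t i) hτ.2 (inv_mem (wordPerm_mem_periodicPerms P.v))
    (P.wiring_succ_eq t i) P.v

/-- The wire ansatz is the limit of the parameters given by `τ` if the four values of `τ` around
each crossing become proportional. -/
theorem tendsto_tauParam {τ : (ZMod n → ℤ) → ℝ} {F : Filter ℤ}
    (hF : ∀ s x y : ZMod n → ℤ, Tendsto (fun i : ℤ => τ (s + i • P.stateVec) *
      τ (s + x + y + i • P.stateVec) /
      (τ (s + x + i • P.stateVec) * τ (s + y + i • P.stateVec))) F (𝓝 1))
    (t : ℤ) (g : Equiv.Perm ℤ) (ω : List (ZMod n)) :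
    Tendsto (fun i : ℤ => tauParam P.α (fun s => τ (s + (i • P.stateVec - t • P.carrierVec))) g ω)
      F (𝓝 (wireParam P.α g ω)) := by
  refine tendsto_pi_nhds.2 fun p => ?_
  have := (hF (latticeVec n (chamberBelow g ω p) - t • P.carrierVec)
    (stdVec (upperWire g ω p)) (stdVec (lowerWire g ω p))).const_mul
    (P.α (upperWire g ω p) - P.α (lowerWire g ω p))
  rw [mul_one] at this
  refine this.congr fun i => ?_
  have e : ∀ s : ZMod n → ℤ, s + (i • P.stateVec - t • P.carrierVec) =
      s - t • P.carrierVec + i • P.stateVec := fun s => by abel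
  simp only [tauParam, mul_div_assoc, e, add_sub_right_comm]

/-- A positive cylindric Berenstein–Hirota–Zelevinsky datum with the right asymptotics gives a
solution of affine dKdV. -/
theorem isSolution_of_tau {τ : (ZMod n → ℤ) → ℝ} (hτ : IsCylindricBHZ P.α τ)
    (h0 : ∀ s, 0 < τ s)
    (hF : ∀ F : Filter ℤ, F = atTop ∨ F = atBot → ∀ s x y : ZMod n → ℤ,
      Tendsto (fun i : ℤ => τ (s + i • P.stateVec) * τ (s + x + y + i • P.stateVec) /
        (τ (s + x + i • P.stateVec) * τ (s + y + i • P.stateVec))) F (𝓝 1)) :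
    P.IsSolution (P.tauState P.wiring τ) (P.tauCarrier P.wiring τ) where
  state_pos t i p := by
    rw [P.tauState_wiring hτ]
    exact tauParam_pos (fun _ => h0 _) (P.weights_lt_state p)
  tendsto_left t := by
    simp only [funext (P.tauState_wiring hτ t)]
    exact P.tendsto_tauParam (hF _ (.inr rfl)) t 1 P.u
  tendsto_right t := by
    simp only [funext (P.tauState_wiring hτ t)]
    exact P.tendsto_tauParam (hF _ (.inl rfl)) t 1 P.u
  step t :=
    { carrier_pos := fun i p => by
        rw [P.tauCarrier_wiring hτ]
        exact tauParam_pos (fun _ => h0 _) (P.weights_lt_carrier p)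
      carrier_init := by
        simp only [funext (P.tauCarrier_wiring hτ t)]
        exact P.tendsto_tauParam (hF _ (.inr rfl)) t _ P.v
      interacts := fun i => by
        rw [P.tauState_wiring hτ, P.tauState_wiring hτ, P.tauCarrier_wiring hτ,
          P.tauCarrier_wiring hτ]
        convert P.interacts_tauParam (hτ.add
          (i • P.stateVec - t • P.carrierVec)) (fun _ => h0 _) using 4
        · rw [add_smul, one_smul, add_assoc]; congr 1; abel
        · rw [add_smul, one_smul, add_assoc]; congr 1; abel }

theorem interacts_vacuum :
    Interacts P.u P.v P.initialCarrier P.vacuum P.vacuum P.initialCarrier := by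
  have h : ∀ (g : Equiv.Perm ℤ) (ω : List (ZMod n)),
      wireParam P.α g ω = tauParam P.α (fun _ => 1) g ω := fun g ω => by
    ext p; simp [wireParam, tauParam]
  rw [initialCarrier, vacuum, h, h]
  refine P.interacts_tauParam ⟨fun s i j k _ _ _ => by ring, fun _ => rfl⟩ fun _ => one_pos

end AffineDKdV

/-! ### Hirota's bilinear identity for soliton sums -/

section Pairs

variable {N : ℕ}

/-- The product over all pairs `a < d`. -/
def pairProd (F : Fin N → Fin N → ℝ) : ℝ :=
  ∏ q ∈ Finset.univ.filter (fun q : Fin N × Fin N => q.1 < q.2), F q.1 q.2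

theorem pairProd_mul (F G : Fin N → Fin N → ℝ) :
    pairProd F * pairProd G = pairProd fun a d => F a d * G a d :=
  (Finset.prod_mul_distrib).symm

theorem pairProd_congr {F G : Fin N → Fin N → ℝ} (h : ∀ a d, a < d → F a d = G a d) :
    pairProd F = pairProd G :=
  Finset.prod_congr rfl fun _ hq => h _ _ (Finset.mem_filter.1 hq).2

theorem pairProd_ne_zero {F : Fin N → Fin N → ℝ} (h : ∀ a d, a < d → F a d ≠ 0) :
    pairProd F ≠ 0 :=
  Finset.prod_ne_zero_iff.2 fun _ hq => h _ _ (Finset.mem_filter.1 hq).2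

theorem pairProd_eq (F : Fin N → Fin N → ℝ) :
    pairProd F = ∏ a, ∏ d, if a < d then F a d else 1 := by
  rw [pairProd, Finset.prod_filter, Fintype.prod_prod_type]

theorem pairProd_mul_swap (F : Fin N → Fin N → ℝ) :
    (pairProd fun a d => F a d * F d a) = ∏ a, ∏ d ∈ Finset.univ.erase a, F a d := by
  rw [← pairProd_mul, pairProd_eq, pairProd_eq, Finset.prod_comm (f := fun a d =>
    if a < d then F d a else 1), ← Finset.prod_mul_distrib]
  refine Finset.prod_congr rfl fun a _ => ?_
  rw [← Finset.prod_mul_distrib, ← Finset.filter_ne', Finset.prod_filter]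
  refine Finset.prod_congr rfl fun d _ => ?_
  rcases lt_trichotomy a d with h | rfl | h
  · simp [h, h.ne', h.not_gt]
  · simp
  · simp [h, h.ne, h.not_gt]

/-- The factors of a symmetric product over pairs that involve a given index. -/
theorem pairProd_split {F : Fin N → Fin N → ℝ} (hF : ∀ a d, F a d = F d a) (a : Fin N) :
    pairProd F = (pairProd fun c d => if c = a ∨ d = a then 1 else F c d) *
      ∏ d ∈ Finset.univ.erase a, F a d := by
  have h : ∏ d ∈ Finset.univ.erase a, F a d =
      pairProd fun c d => (if c = a then F a d else 1) * (if d = a then F a c else 1) := by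
    rw [pairProd_mul_swap (fun c d => if c = a then F a d else 1)]
    refine Eq.trans ?_ (Finset.prod_eq_single a (fun b _ hb => ?_) (by simp)).symm
    · simp
    · simp [hb]
  rw [h, pairProd_mul]
  refine pairProd_congr fun c d hcd => ?_
  by_cases hc : c = a
  · subst hc
    simp [hcd.ne']
  · by_cases hd : d = a
    · subst hd
      simp [hc, hF c d]
    · simp [hc, hd]

end Pairs

section Lagrange

variable {N : ℕ}

open Polynomial in
/-- Partial fractions of `∏ (z - x_c) / ∏ (z - y_c)`. -/
theorem prod_sub_eq_mul_sum (x : Fin N → ℝ) {y : Fin N → ℝ} (hy : Function.Injective y) {z : ℝ}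
    (hz : ∀ a, z ≠ y a) :
    ∏ c, (z - x c) = (∏ c, (z - y c)) * (1 + ∑ a, (∏ c, (y a - x c)) *
      (∏ c ∈ Finset.univ.erase a, (y a - y c))⁻¹ * (z - y a)⁻¹) := by
  set R : ℝ[X] := Lagrange.nodal Finset.univ x - Lagrange.nodal Finset.univ y with hR
  have hdeg : R.degree < (Finset.univ : Finset (Fin N)).card := by
    have := degree_sub_lt_left (p := Lagrange.nodal Finset.univ x)
      (q := Lagrange.nodal Finset.univ y)
      (by rw [Lagrange.degree_nodal, Lagrange.degree_nodal]) Lagrange.nodal_ne_zero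
      (by rw [Lagrange.nodal_monic.leadingCoeff, Lagrange.nodal_monic.leadingCoeff])
    rwa [Lagrange.degree_nodal] at this
  have hval := congrArg (eval z) (Lagrange.eq_interpolate (v := y) hy.injOn hdeg)
  rw [Lagrange.eval_interpolate_not_at_node _ fun a _ => hz a, hR, eval_sub, Lagrange.eval_nodal,
    Lagrange.eval_nodal] at hval
  rw [mul_add, mul_one, ← sub_eq_iff_eq_add', hval]
  congr 1
  refine Finset.sum_congr rfl fun a _ => ?_
  rw [eval_sub, Lagrange.eval_nodal_at_node (Finset.mem_univ a), sub_zero, Lagrange.eval_nodal,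
    Lagrange.nodalWeight, Finset.prod_inv_distrib]
  ring

/-- The contribution of the node `y a` to Lagrange's identity, up to a factor independent of `x`,
`y` and `a`. -/
def exchangeTerm (p q r : ℝ) (x y : Fin N → ℝ) (a : Fin N) : ℝ :=
  (pairProd fun c d => if c = a ∨ d = a then 1 else (x c - x d) * (y c - y d)) *
    ((y a - x a) * ∏ d ∈ Finset.univ.erase a,
      ((x a - x d) * (y a - x d) * ((p - y d) * (q - y d) * (r - y d))))

/-- Lagrange's identity, cleared of denominators. -/
theorem cyclic_sum_eq_sum_exchangeTerm (p q r : ℝ) (x : Fin N → ℝ) {y : Fin N → ℝ}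
    (hy : Function.Injective y) (hp : ∀ a, p ≠ y a) (hq : ∀ a, q ≠ y a) (hr : ∀ a, r ≠ y a) :
    (pairProd fun c d => x c - x d) * (pairProd fun c d => y c - y d) *
      ((p - q) * (∏ a, (x a - r)) * (∏ a, (y a - p) * (y a - q)) +
        (q - r) * (∏ a, (x a - p)) * (∏ a, (y a - q) * (y a - r)) +
        (r - p) * (∏ a, (x a - q)) * (∏ a, (y a - p) * (y a - r))) =
      ∑ a, -((-1) ^ N * (p - q) * (q - r) * (r - p)) * exchangeTerm p q r x y a := by
  have neg (z : ℝ) (w : Fin N → ℝ) : ∏ a, (w a - z) = (-1) ^ N * ∏ a, (z - w a) := by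
    calc ∏ a, (w a - z) = ∏ a, (-1) * (z - w a) := Finset.prod_congr rfl fun _ _ => by ring
      _ = _ := by rw [Finset.prod_mul_distrib]; simp
  have hsq : ((-1 : ℝ) ^ N) * (-1) ^ N = 1 := by rw [← mul_pow]; simp
  simp only [Finset.prod_mul_distrib, neg]
  rw [prod_sub_eq_mul_sum x hy hp, prod_sub_eq_mul_sum x hy hq, prod_sub_eq_mul_sum x hy hr,
    pairProd_mul]
  set Yp := ∏ c, (p - y c) with hYp
  set Yq := ∏ c, (q - y c) with hYq
  set Yr := ∏ c, (r - y c) with hYr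
  set V := pairProd fun c d => (x c - x d) * (y c - y d) with hV
  set w : Fin N → ℝ := fun a => (∏ c, (y a - x c)) *
    (∏ c ∈ Finset.univ.erase a, (y a - y c))⁻¹ with hw
  change V * ((p - q) * ((-1) ^ N * (Yr * (1 + ∑ a, w a * (r - y a)⁻¹))) *
      ((-1) ^ N * Yp * ((-1) ^ N * Yq)) +
      (q - r) * ((-1) ^ N * (Yp * (1 + ∑ a, w a * (p - y a)⁻¹))) *
      ((-1) ^ N * Yq * ((-1) ^ N * Yr)) +
      (r - p) * ((-1) ^ N * (Yq * (1 + ∑ a, w a * (q - y a)⁻¹))) *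
      ((-1) ^ N * Yp * ((-1) ^ N * Yr))) = _
  have e1 : V * ((p - q) * ((-1) ^ N * (Yr * (1 + ∑ a, w a * (r - y a)⁻¹))) *
      ((-1) ^ N * Yp * ((-1) ^ N * Yq)) +
      (q - r) * ((-1) ^ N * (Yp * (1 + ∑ a, w a * (p - y a)⁻¹))) *
      ((-1) ^ N * Yq * ((-1) ^ N * Yr)) +
      (r - p) * ((-1) ^ N * (Yq * (1 + ∑ a, w a * (q - y a)⁻¹))) *
      ((-1) ^ N * Yp * ((-1) ^ N * Yr))) = (-1) ^ N * V * Yp * Yq * Yr *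
        ((p - q) * ∑ a, w a * (r - y a)⁻¹ + (q - r) * ∑ a, w a * (p - y a)⁻¹ +
          (r - p) * ∑ a, w a * (q - y a)⁻¹) := by
    linear_combination (-1) ^ N * V * Yp * Yq * Yr *
        ((p - q) * ∑ a, w a * (r - y a)⁻¹ + (q - r) * ∑ a, w a * (p - y a)⁻¹ +
          (r - p) * ∑ a, w a * (q - y a)⁻¹) * hsq
  rw [e1, Finset.mul_sum, Finset.mul_sum, Finset.mul_sum, ← Finset.sum_add_distrib,
    ← Finset.sum_add_distrib, Finset.mul_sum]
  refine Finset.sum_congr rfl fun a _ => ?_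
  have np := sub_ne_zero.2 (hp a)
  have nq := sub_ne_zero.2 (hq a)
  have nr := sub_ne_zero.2 (hr a)
  have hV' := pairProd_split (F := fun c d => (x c - x d) * (y c - y d))
    (fun c d => by ring) a
  have ny : ∏ c ∈ Finset.univ.erase a, (y a - y c) ≠ 0 :=
    Finset.prod_ne_zero_iff.2 fun c hc =>
      sub_ne_zero.2 fun h => (Finset.ne_of_mem_erase hc) (hy h).symm
  rw [hV, hV', hYp, hYq, hYr, hw, exchangeTerm]
  dsimp only
  rw [← Finset.mul_prod_erase _ _ (Finset.mem_univ a), ← Finset.mul_prod_erase _ _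
    (Finset.mem_univ a), ← Finset.mul_prod_erase _ _ (Finset.mem_univ a),
    ← Finset.mul_prod_erase _ (fun c => y a - x c) (Finset.mem_univ a)]
  simp only [Finset.prod_mul_distrib]
  field_simp
  ring

/-- Exchanging the entries of two families at the index `a`. -/
def exchangeAt {ι κ : Type*} [DecidableEq ι] (a : ι) (ε : (ι → κ) × (ι → κ)) :
    (ι → κ) × (ι → κ) :=
  (Function.update ε.1 a (ε.2 a), Function.update ε.2 a (ε.1 a))

theorem exchangeAt_involutive {ι κ : Type*} [DecidableEq ι] (a : ι) :
    Function.Involutive (exchangeAt (κ := κ) a) := by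
  rintro ⟨ε, ε'⟩
  simp [exchangeAt]

/-- The terms of Lagrange's identity are antisymmetric in the two nodes with the same index. -/
theorem exchangeTerm_exchangeAt (p q r : ℝ) (x y x' y' : Fin N → ℝ) (a : Fin N)
    (hx : ∀ c, c ≠ a → x' c = x c) (hy : ∀ c, c ≠ a → y' c = y c) (hxa : x' a = y a)
    (hya : y' a = x a) : exchangeTerm p q r x' y' a = -exchangeTerm p q r x y a := by
  have e1 : (pairProd fun c d => if c = a ∨ d = a then 1 else (x' c - x' d) * (y' c - y' d)) =
      pairProd fun c d => if c = a ∨ d = a then 1 else (x c - x d) * (y c - y d) := by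
    refine pairProd_congr fun c d _ => ?_
    split_ifs with h
    · rfl
    · push Not at h
      rw [hx c h.1, hx d h.2, hy c h.1, hy d h.2]
  have e2 : ∏ d ∈ Finset.univ.erase a,
      ((x' a - x' d) * (y' a - x' d) * ((p - y' d) * (q - y' d) * (r - y' d))) =
      ∏ d ∈ Finset.univ.erase a,
      ((x a - x d) * (y a - x d) * ((p - y d) * (q - y d) * (r - y d))) := by
    refine Finset.prod_congr rfl fun d hd => ?_
    have hd := Finset.ne_of_mem_erase hd
    rw [hx d hd, hy d hd, hxa, hya]
    ring
  rw [exchangeTerm, exchangeTerm, e1, e2, hxa, hya]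
  ring

/-- The Casorati expansion: a sum over the choices of one of two nodes for each index, of the
Vandermonde product of the nodes with a weight for each node. -/
def casoratiSum (pt g : Fin N → Bool → ℝ) (h : ℝ → ℝ) : ℝ :=
  ∑ ε : Fin N → Bool, (pairProd fun c d => pt c (ε c) - pt d (ε d)) *
    ∏ a, g a (ε a) * h (pt a (ε a))

/-- Hirota's identity for Casorati expansions.  In Lagrange's identity for the nodes of the second
factor, the terms of these nodes cancel under exchanging the choices of the two factors at one
index. -/
theorem casoratiSum_bilinear (pt g : Fin N → Bool → ℝ) (p q r : ℝ)
    (hpt : ∀ a d e e', a ≠ d → pt a e ≠ pt d e') (hp : ∀ a e, p ≠ pt a e)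
    (hq : ∀ a e, q ≠ pt a e) (hr : ∀ a e, r ≠ pt a e) :
    (p - q) * casoratiSum pt g (fun z => z - r) * casoratiSum pt g (fun z => (z - p) * (z - q)) +
      (q - r) * casoratiSum pt g (fun z => z - p) *
        casoratiSum pt g (fun z => (z - q) * (z - r)) +
      (r - p) * casoratiSum pt g (fun z => z - q) *
        casoratiSum pt g (fun z => (z - p) * (z - r)) = 0 := by
  have key : ∀ ε ε' : Fin N → Bool, ((∏ a, g a (ε a)) * ∏ a, g a (ε' a)) *
      ((pairProd fun c d => pt c (ε c) - pt d (ε d)) *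
        (pairProd fun c d => pt c (ε' c) - pt d (ε' d)) *
      ((p - q) * (∏ a, (pt a (ε a) - r)) * (∏ a, (pt a (ε' a) - p) * (pt a (ε' a) - q)) +
        (q - r) * (∏ a, (pt a (ε a) - p)) * (∏ a, (pt a (ε' a) - q) * (pt a (ε' a) - r)) +
        (r - p) * (∏ a, (pt a (ε a) - q)) * (∏ a, (pt a (ε' a) - p) * (pt a (ε' a) - r)))) =
      ∑ a, -((-1) ^ N * (p - q) * (q - r) * (r - p)) * (((∏ a, g a (ε a)) * ∏ a, g a (ε' a)) *
        exchangeTerm p q r (fun a => pt a (ε a)) (fun a => pt a (ε' a)) a) := by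
    intro ε ε'
    rw [cyclic_sum_eq_sum_exchangeTerm p q r (fun a => pt a (ε a)) (y := fun a => pt a (ε' a))
      (fun a d h => by_contra fun had => hpt a d _ _ had h) (fun a => hp a _) (fun a => hq a _)
      (fun a => hr a _), Finset.mul_sum]
    exact Finset.sum_congr rfl fun a _ => by ring
  have hzero : ∀ a, ∑ ε : (Fin N → Bool) × (Fin N → Bool),
      ((∏ a, g a (ε.1 a)) * ∏ a, g a (ε.2 a)) *
        exchangeTerm p q r (fun a => pt a (ε.1 a)) (fun a => pt a (ε.2 a)) a = 0 := by
    intro a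
    have := Equiv.sum_comp (exchangeAt_involutive (κ := Bool) a).toPerm fun ε =>
      ((∏ a, g a (ε.1 a)) * ∏ a, g a (ε.2 a)) *
        exchangeTerm p q r (fun a => pt a (ε.1 a)) (fun a => pt a (ε.2 a)) a
    have hneg : ∀ ε : (Fin N → Bool) × (Fin N → Bool),
        ((∏ c, g c ((exchangeAt a ε).1 c)) * ∏ c, g c ((exchangeAt a ε).2 c)) *
          exchangeTerm p q r (fun c => pt c ((exchangeAt a ε).1 c))
            (fun c => pt c ((exchangeAt a ε).2 c)) a =
        -(((∏ c, g c (ε.1 c)) * ∏ c, g c (ε.2 c)) *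
          exchangeTerm p q r (fun c => pt c (ε.1 c)) (fun c => pt c (ε.2 c)) a) := by
      intro ε
      rw [exchangeTerm_exchangeAt p q r (fun c => pt c (ε.1 c)) (fun c => pt c (ε.2 c)) _ _ a
        (fun c hc => by simp [exchangeAt, hc]) (fun c hc => by simp [exchangeAt, hc])
        (by simp [exchangeAt]) (by simp [exchangeAt]), mul_neg, ← Finset.prod_mul_distrib,
        ← Finset.prod_mul_distrib]
      congr 2
      refine Finset.prod_congr rfl fun c _ => ?_
      by_cases hc : c = a
      · subst hc; simp [exchangeAt, mul_comm]
      · simp [exchangeAt, hc]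
    simp only [Function.Involutive.coe_toPerm, hneg, Finset.sum_neg_distrib] at this
    linarith
  have hexp : ∀ h h' : ℝ → ℝ, casoratiSum pt g h * casoratiSum pt g h' =
      ∑ ε : (Fin N → Bool) × (Fin N → Bool), ((∏ a, g a (ε.1 a)) * ∏ a, g a (ε.2 a)) *
        ((pairProd fun c d => pt c (ε.1 c) - pt d (ε.1 d)) *
          (pairProd fun c d => pt c (ε.2 c) - pt d (ε.2 d)) *
          ((∏ a, h (pt a (ε.1 a))) * ∏ a, h' (pt a (ε.2 a)))) := by
    intro h h'
    rw [casoratiSum, casoratiSum, Finset.sum_mul_sum, Fintype.sum_prod_type]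
    refine Finset.sum_congr rfl fun ε _ => Finset.sum_congr rfl fun ε' _ => ?_
    rw [Finset.prod_mul_distrib, Finset.prod_mul_distrib]
    ring
  rw [mul_assoc, mul_assoc, mul_assoc, hexp, hexp, hexp, Finset.mul_sum, Finset.mul_sum,
    Finset.mul_sum, ← Finset.sum_add_distrib, ← Finset.sum_add_distrib]
  calc _ = ∑ ε : (Fin N → Bool) × (Fin N → Bool),
        ∑ a, -((-1) ^ N * (p - q) * (q - r) * (r - p)) *
          (((∏ a, g a (ε.1 a)) * ∏ a, g a (ε.2 a)) *
            exchangeTerm p q r (fun a => pt a (ε.1 a)) (fun a => pt a (ε.2 a)) a) := by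
        refine Finset.sum_congr rfl fun ε _ => ?_
        rw [← key ε.1 ε.2]
        ring
    _ = 0 := by
        rw [Finset.sum_comm]
        refine Finset.sum_eq_zero fun a _ => ?_
        rw [← Finset.mul_sum, hzero, mul_zero]

end Lagrange

section SolitonSum

variable {N : ℕ}

/-- The sum over subsets of an `N`-soliton `τ`-function, as a function of the factors `f_i`. -/
noncomputable def solitonSum (b c f : Fin N → ℝ) : ℝ :=
  ∑ T : Finset (Fin N),
    (∏ q ∈ (T ×ˢ T).filter (fun q => q.1 < q.2), solitonZ b c q.1 q.2) * ∏ i ∈ T, f i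

theorem solitonSum_eq (b c f : Fin N → ℝ) :
    solitonSum b c f = ∑ ε : Fin N → Bool,
      (pairProd fun a d => if ε a ∧ ε d then solitonZ b c a d else 1) *
        ∏ a, if ε a then f a else 1 := by
  let e : (Fin N → Bool) ≃ Finset (Fin N) :=
    { toFun := fun ε => Finset.univ.filter fun a => ε a
      invFun := fun T a => decide (a ∈ T)
      left_inv := fun ε => by ext a; simp
      right_inv := fun T => by ext a; simp }
  rw [solitonSum, ← Equiv.sum_comp e]
  refine Finset.sum_congr rfl fun ε _ => ?_
  congr 1
  · rw [pairProd, ← Finset.prod_filter]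
    refine Finset.prod_congr ?_ fun _ _ => rfl
    ext q
    simp [e, and_comm]
  · simp only [e, Equiv.coe_fn_mk]
    rw [Finset.prod_filter]

/-- After multiplication by a Vandermonde product, an `N`-soliton sum is a Casorati expansion. -/
theorem solitonSum_mul {b c : Fin N → ℝ} (hc : Function.Injective c)
    (hbc : ∀ a d, a ≠ d → b a ≠ c d) (f : Fin N → ℝ) (h : ℝ → ℝ) (hh : ∀ a, h (c a) ≠ 0) :
    solitonSum b c (fun a => f a * (h (b a) / h (c a))) *
        ((pairProd fun a d => c a - c d) * ∏ a, h (c a)) =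
      casoratiSum (fun a e => if e then b a else c a)
        (fun a e => if e then f a / ∏ d ∈ Finset.univ.erase a, (b a - c d) / (c a - c d) else 1)
        h := by
  rw [solitonSum_eq, casoratiSum, Finset.sum_mul]
  refine Finset.sum_congr rfl fun ε _ => ?_
  set R : Fin N → ℝ := fun a => ∏ d ∈ Finset.univ.erase a, (b a - c d) / (c a - c d) with hR
  have nc {a d : Fin N} (had : a ≠ d) : c a - c d ≠ 0 := sub_ne_zero.2 fun e => had (hc e)
  have nbc {a d : Fin N} (had : a ≠ d) : b a - c d ≠ 0 := sub_ne_zero.2 (hbc a d had)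
  have hR0 (a : Fin N) : R a ≠ 0 := Finset.prod_ne_zero_iff.2 fun d hd =>
    div_ne_zero (nbc (Finset.ne_of_mem_erase hd).symm) (nc (Finset.ne_of_mem_erase hd).symm)
  have h1 : ∏ a, (if ε a then R a else 1) = pairProd fun a d =>
      (if ε a then (b a - c d) / (c a - c d) else 1) *
        (if ε d then (b d - c a) / (c d - c a) else 1) := by
    rw [pairProd_mul_swap fun a d => if ε a then (b a - c d) / (c a - c d) else 1]
    refine Finset.prod_congr rfl fun a _ => ?_
    split_ifs
    · rfl
    · simp
  have h2 : (pairProd fun a d => (if ε a then b a else c a) - (if ε d then b d else c d)) =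
      (pairProd fun a d => if ε a ∧ ε d then solitonZ b c a d else 1) *
        (pairProd fun a d => c a - c d) * ∏ a, (if ε a then R a else 1) := by
    rw [h1, pairProd_mul, pairProd_mul]
    refine pairProd_congr fun a d had => ?_
    have n1 := nc had.ne
    have n2 := nc had.ne'
    have n3 := nbc had.ne
    have n4 := nbc had.ne'
    have n5 : c a - b d ≠ 0 := sub_ne_zero.2 (hbc d a had.ne').symm
    by_cases ha : ε a <;> by_cases hd : ε d <;> simp only [ha, hd, solitonZ] <;> simp
    · field_simp
      ring
    · field_simp
    · field_simp
      ring
  have h3 : ∏ a, (if ε a then f a / R a else 1) * h (if ε a then b a else c a) *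
      (if ε a then R a else 1) =
      ∏ a, (if ε a then f a * (h (b a) / h (c a)) else 1) * h (c a) := by
    refine Finset.prod_congr rfl fun a _ => ?_
    have := hR0 a
    have := hh a
    split_ifs
    · field_simp
    · ring
  rw [Finset.prod_mul_distrib, Finset.prod_mul_distrib (g := fun a => h (c a))] at h3
  rw [h2]
  linear_combination -((pairProd fun a d => if ε a ∧ ε d then solitonZ b c a d else 1) *
    (pairProd fun a d => c a - c d)) * h3

/-- Hirota's identity for soliton sums with distinct nodes. -/
theorem solitonSum_bilinear_of_injective {b c : Fin N → ℝ} (hb : Function.Injective b)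
    (hc : Function.Injective c) (hbc : ∀ a d, a ≠ d → b a ≠ c d) (f : Fin N → ℝ) {p q r : ℝ}
    (hbp : ∀ a, b a ≠ p) (hbq : ∀ a, b a ≠ q) (hbr : ∀ a, b a ≠ r)
    (hcp : ∀ a, c a ≠ p) (hcq : ∀ a, c a ≠ q) (hcr : ∀ a, c a ≠ r) :
    (p - q) * solitonSum b c (fun a => f a * ((b a - r) / (c a - r))) *
        solitonSum b c (fun a => f a * (((b a - p) * (b a - q)) / ((c a - p) * (c a - q)))) +
      (q - r) * solitonSum b c (fun a => f a * ((b a - p) / (c a - p))) *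
        solitonSum b c (fun a => f a * (((b a - q) * (b a - r)) / ((c a - q) * (c a - r)))) +
      (r - p) * solitonSum b c (fun a => f a * ((b a - q) / (c a - q))) *
        solitonSum b c (fun a => f a * (((b a - p) * (b a - r)) / ((c a - p) * (c a - r)))) =
      0 := by
  have sp (a) := sub_ne_zero.2 (hcp a)
  have sq (a) := sub_ne_zero.2 (hcq a)
  have sr (a) := sub_ne_zero.2 (hcr a)
  have e1 := solitonSum_mul hc hbc f (fun z => z - p) sp
  have e2 := solitonSum_mul hc hbc f (fun z => z - q) sq
  have e3 := solitonSum_mul hc hbc f (fun z => z - r) sr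
  have e4 := solitonSum_mul hc hbc f (fun z => (z - p) * (z - q))
    fun a => mul_ne_zero (sp a) (sq a)
  have e5 := solitonSum_mul hc hbc f (fun z => (z - q) * (z - r))
    fun a => mul_ne_zero (sq a) (sr a)
  have e6 := solitonSum_mul hc hbc f (fun z => (z - p) * (z - r))
    fun a => mul_ne_zero (sp a) (sr a)
  have key := casoratiSum_bilinear (fun a e => if e then b a else c a)
    (fun a e => if e then f a / ∏ d ∈ Finset.univ.erase a, (b a - c d) / (c a - c d) else 1) p q r
    (fun a d e e' had => by
      cases e <;> cases e' <;> simp only [if_true, Bool.false_eq_true, if_false]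
      exacts [hc.ne had, (hbc d a had.symm).symm, hbc a d had, hb.ne had])
    (fun a e => by cases e <;> simp [(hbp a).symm, (hcp a).symm])
    (fun a e => by cases e <;> simp [(hbq a).symm, (hcq a).symm])
    (fun a e => by cases e <;> simp [(hbr a).symm, (hcr a).symm])
  rw [← e1, ← e2, ← e3, ← e4, ← e5, ← e6] at key
  simp only [Finset.prod_mul_distrib] at key
  have n1 : (pairProd fun a d => c a - c d) ≠ 0 :=
    pairProd_ne_zero fun a d had => sub_ne_zero.2 (hc.ne had.ne)
  have n2 : ∏ a, (c a - p) ≠ 0 := Finset.prod_ne_zero_iff.2 fun a _ => sp a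
  have n3 : ∏ a, (c a - q) ≠ 0 := Finset.prod_ne_zero_iff.2 fun a _ => sq a
  have n4 : ∏ a, (c a - r) ≠ 0 := Finset.prod_ne_zero_iff.2 fun a _ => sr a
  refine (mul_eq_zero.1 ?_).resolve_right (mul_ne_zero (mul_ne_zero (mul_ne_zero n1 n1) n2)
    (mul_ne_zero n3 n4))
  linear_combination key

theorem tendsto_solitonSum {b c f : ℝ → Fin N → ℝ} {F : Filter ℝ} {b₀ c₀ f₀ : Fin N → ℝ}
    (hb : ∀ a, Tendsto (fun t => b t a) F (𝓝 (b₀ a)))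
    (hc : ∀ a, Tendsto (fun t => c t a) F (𝓝 (c₀ a)))
    (hf : ∀ a, Tendsto (fun t => f t a) F (𝓝 (f₀ a))) (hbc : ∀ a d, a ≠ d → b₀ a ≠ c₀ d) :
    Tendsto (fun t => solitonSum (b t) (c t) (f t)) F (𝓝 (solitonSum b₀ c₀ f₀)) := by
  refine tendsto_finsetSum _ fun T _ => (tendsto_finsetProd _ fun q hq => ?_).mul
    (tendsto_finsetProd _ fun a _ => hf a)
  have hq := (Finset.mem_filter.1 hq).2
  exact (((hb _).sub (hb _)).mul ((hc _).sub (hc _))).div (((hb _).sub (hc _)).mul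
    ((hc _).sub (hb _))) (mul_ne_zero (sub_ne_zero.2 (hbc _ _ hq.ne))
      (sub_ne_zero.2 (hbc _ _ hq.ne').symm))

/-- Shifting the entries of a family by different multiples of a small parameter makes them
distinct. -/
theorem eventually_injective (b : Fin N → ℝ) :
    ∀ᶠ t : ℝ in 𝓝[≠] 0, Function.Injective fun a : Fin N => b a + t * (a : ℕ) := by
  have : ∀ a d : Fin N, a ≠ d → ∀ᶠ t : ℝ in 𝓝[≠] 0, b a + t * (a : ℕ) ≠ b d + t * (d : ℕ) := by
    intro a d had
    by_cases h : b a = b d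
    · filter_upwards [self_mem_nhdsWithin] with t ht e
      have ht : t ≠ 0 := ht
      rw [h, add_right_inj] at e
      exact had (Fin.ext (by exact_mod_cast mul_left_cancel₀ ht e))
    · have hcont : Continuous fun t : ℝ => b a + t * (a : ℕ) - (b d + t * (d : ℕ)) := by fun_prop
      have := hcont.continuousAt.eventually_ne (x := 0) (y := 0) (by simpa [sub_eq_zero] using h)
      exact (this.filter_mono nhdsWithin_le_nhds).mono fun t ht e => ht (sub_eq_zero.2 e)
  have := eventually_all.2 fun a => eventually_all.2 fun d =>
    eventually_imp_distrib_left.2 (this a d)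
  exact this.mono fun t ht a d e => by_contra fun had => ht a d had e

/-- Hirota's identity for soliton sums. -/
theorem solitonSum_bilinear {b c : Fin N → ℝ} (hbc : ∀ a d, a ≠ d → b a ≠ c d) (f : Fin N → ℝ)
    {p q r : ℝ} (hbp : ∀ a, b a ≠ p) (hbq : ∀ a, b a ≠ q) (hbr : ∀ a, b a ≠ r)
    (hcp : ∀ a, c a ≠ p) (hcq : ∀ a, c a ≠ q) (hcr : ∀ a, c a ≠ r) :
    (p - q) * solitonSum b c (fun a => f a * ((b a - r) / (c a - r))) *
        solitonSum b c (fun a => f a * (((b a - p) * (b a - q)) / ((c a - p) * (c a - q)))) +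
      (q - r) * solitonSum b c (fun a => f a * ((b a - p) / (c a - p))) *
        solitonSum b c (fun a => f a * (((b a - q) * (b a - r)) / ((c a - q) * (c a - r)))) +
      (r - p) * solitonSum b c (fun a => f a * ((b a - q) / (c a - q))) *
        solitonSum b c (fun a => f a * (((b a - p) * (b a - r)) / ((c a - p) * (c a - r)))) =
      0 := by
  have hlim (b : Fin N → ℝ) (a : Fin N) :
      Tendsto (fun t : ℝ => b a + t * (a : ℕ)) (𝓝[≠] 0) (𝓝 (b a)) := by
    have : Continuous fun t : ℝ => b a + t * (a : ℕ) := by fun_prop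
    simpa using (this.tendsto 0).mono_left nhdsWithin_le_nhds
  have hne (b : Fin N → ℝ) {p : ℝ} (h : ∀ a, b a ≠ p) :
      ∀ᶠ t : ℝ in 𝓝[≠] 0, ∀ a, b a + t * (a : ℕ) ≠ p :=
    eventually_all.2 fun a => (hlim b a).eventually_ne (h a)
  have hne' : ∀ᶠ t : ℝ in 𝓝[≠] 0, ∀ a d : Fin N, a ≠ d →
      b a + t * (a : ℕ) ≠ c d + t * (d : ℕ) := by
    refine eventually_all.2 fun a => eventually_all.2 fun d => eventually_imp_distrib_left.2
      fun had => ?_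
    exact (((hlim b a).sub (hlim c d)).eventually_ne (sub_ne_zero.2 (hbc a d had))).mono
      fun t ht => sub_ne_zero.1 ht
  have h1 {p : ℝ} (hp : ∀ a, c a ≠ p) := tendsto_solitonSum (hlim b) (hlim c) (fun a =>
    (((hlim b a).sub_const p).div ((hlim c a).sub_const p) (sub_ne_zero.2 (hp a))).const_mul (f a))
    hbc
  have h2 {p q : ℝ} (hp : ∀ a, c a ≠ p) (hq : ∀ a, c a ≠ q) :=
    tendsto_solitonSum (hlim b) (hlim c) (fun a =>
      ((((hlim b a).sub_const p).mul ((hlim b a).sub_const q)).div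
        (((hlim c a).sub_const p).mul ((hlim c a).sub_const q))
        (mul_ne_zero (sub_ne_zero.2 (hp a)) (sub_ne_zero.2 (hq a)))).const_mul (f a)) hbc
  refine tendsto_nhds_unique ((((h1 hcr).const_mul (p - q)).mul (h2 hcp hcq)).add
    (((h1 hcp).const_mul (q - r)).mul (h2 hcq hcr)) |>.add
    (((h1 hcq).const_mul (r - p)).mul (h2 hcp hcr))) (tendsto_const_nhds.congr' ?_)
  filter_upwards [eventually_injective b, eventually_injective c, hne', hne b hbp, hne b hbq,
    hne b hbr, hne c hcp, hne c hcq, hne c hcr] with t t1 t2 t3 t4 t5 t6 t7 t8 t9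
  exact (solitonSum_bilinear_of_injective t1 t2 t3 f t4 t5 t6 t7 t8 t9).symm

end SolitonSum

/-! ### The soliton `τ`-function -/

section SolitonTau

variable {n : ℕ} [Fact (3 ≤ n)] {N : ℕ}

theorem solitonTau_eq (α : ZMod n → ℝ) (A b c : Fin N → ℝ) (s : ZMod n → ℤ) :
    solitonTau α A b c s =
      solitonSum b c fun i => solitonFactor α (A i) (b i) (c i) s := rfl

theorem solitonFactor_add {α : ZMod n → ℝ} {A b c : ℝ} (hb : ∀ j, b ≠ α j) (hc : ∀ j, c ≠ α j)
    (s m : ZMod n → ℤ) : solitonFactor α A b c (s + m) =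
      solitonFactor α A b c s * ∏ j, ((b - α j) / (c - α j)) ^ m j := by
  rw [solitonFactor, solitonFactor, mul_assoc, ← Finset.prod_mul_distrib]
  congr 1
  exact Finset.prod_congr rfl fun j _ =>
    zpow_add₀ (div_ne_zero (sub_ne_zero.2 (hb j)) (sub_ne_zero.2 (hc j))) _ _

theorem prod_zpow_stdVec (x : ZMod n → ℝ) (k : ZMod n) : ∏ j, x j ^ stdVec k j = x k := by
  rw [Finset.prod_eq_single k]
  · simp [stdVec]
  · intro j _ hj
    simp [stdVec, hj]
  · simp

theorem isBHZ_solitonTau {α : ZMod n → ℝ} {A b c : Fin N → ℝ} (h : AdmissiblePairs α b c) :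
    IsBHZ α (solitonTau α A b c) := by
  intro s i j k _ _ _
  have := solitonSum_bilinear (b := b) (c := c) h.b_ne_c
    (fun a => solitonFactor α (A a) (b a) (c a) s) (fun a => h.b_ne a i) (fun a => h.b_ne a j)
    (fun a => h.b_ne a k) (fun a => h.c_ne a i) (fun a => h.c_ne a j) (fun a => h.c_ne a k)
  simp only [solitonTau_eq, solitonFactor_add (h.b_ne _) (h.c_ne _), prod_zpow_stdVec]
  simp only [mul_assoc, div_mul_div_comm]
  simp only [mul_assoc] at this
  exact this

theorem isCylindricBHZ_solitonTau {α : ZMod n → ℝ} {A b c : Fin N → ℝ}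
    (h : AdmissiblePairs α b c) (h' : CylindricPairs α b c) :
    IsCylindricBHZ α (solitonTau α A b c) := by
  refine ⟨isBHZ_solitonTau h, fun s => ?_⟩
  rw [solitonTau_eq, solitonTau_eq]
  congr 1
  ext a
  rw [solitonFactor_add (h.b_ne a) (h.c_ne a)]
  simp only [Pi.one_apply, zpow_one, Finset.prod_div_distrib]
  rw [h' a, div_self, mul_one]
  exact Finset.prod_ne_zero_iff.2 fun j _ => sub_ne_zero.2 (h.c_ne a j)

end SolitonTau

/-! ### The logarithmic potential of the weights -/

section LogPotential

variable {ι : Type*} [Fintype ι]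

/-- `∑ log |x - α_j|` is strictly concave between the `α_j`, so on a pair of points
with equal values it is smaller than between them. -/
theorem sum_log_lt_of_between [Nonempty ι] {α : ι → ℝ} {x y z : ℝ} (hxy : x < y) (hyz : y < z)
    (hs : ∀ j, 0 < (x - α j) * (z - α j))
    (h : ∑ j, Real.log (x - α j) = ∑ j, Real.log (z - α j)) :
    ∑ j, Real.log (x - α j) < ∑ j, Real.log (y - α j) := by
  have hxz := hxy.trans hyz
  have hz : 0 < z - x := sub_pos.2 hxz
  have key (j : ι) : (z - y) / (z - x) * Real.log (x - α j) +
      (y - x) / (z - x) * Real.log (z - α j) < Real.log (y - α j) := by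
    have hne : x - α j ≠ z - α j := fun e => hxz.ne (by linarith)
    have p1 : 0 < (z - y) / (z - x) := div_pos (sub_pos.2 hyz) hz
    have p2 : 0 < (y - x) / (z - x) := div_pos (sub_pos.2 hxy) hz
    have p3 : (z - y) / (z - x) + (y - x) / (z - x) = 1 := by field_simp; ring
    have e : (z - y) / (z - x) * (x - α j) + (y - x) / (z - x) * (z - α j) = y - α j := by
      field_simp; ring
    rcases pos_and_pos_or_neg_and_neg_of_mul_pos (hs j) with ⟨h1, h2⟩ | ⟨h1, h2⟩
    · have := strictConcaveOn_log_Ioi.2 (x := x - α j) h1 (y := z - α j) h2 hne p1 p2 p3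
      simpa only [smul_eq_mul, e] using this
    · have := strictConcaveOn_log_Iio.2 (x := x - α j) h1 (y := z - α j) h2 hne p1 p2 p3
      simpa only [smul_eq_mul, e] using this
  have hsum := Finset.sum_lt_sum_of_nonempty Finset.univ_nonempty fun j _ => key j
  rw [Finset.sum_add_distrib, ← Finset.mul_sum, ← Finset.mul_sum, ← h, ← add_mul] at hsum
  have p3 : (z - y) / (z - x) + (y - x) / (z - x) = 1 := by field_simp; ring
  rwa [p3, one_mul] at hsum

/-- Two pairs of points on level sets of `∑ log |x - α_j|` do not separate each other. -/
theorem cross_pos_of_lt [Nonempty ι] {α : ι → ℝ} {p q x y : ℝ} (hpq : p < q) (hxy : x < y)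
    (s1 : ∀ j, 0 < (p - α j) * (q - α j)) (s2 : ∀ j, 0 < (x - α j) * (y - α j))
    (l1 : ∑ j, Real.log (p - α j) = ∑ j, Real.log (q - α j))
    (l2 : ∑ j, Real.log (x - α j) = ∑ j, Real.log (y - α j))
    (hpx : p ≠ x) (hqy : q ≠ y) (hpy : p ≠ y) (hqx : q ≠ x) :
    0 < (p - x) * (q - y) * ((p - y) * (q - x)) := by
  rcases hpx.lt_or_gt with h | h
  · rcases hqx.lt_or_gt with h' | h'
    · exact mul_pos (mul_pos_of_neg_of_neg (by linarith) (by linarith))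
        (mul_pos_of_neg_of_neg (by linarith) (by linarith))
    · rcases hqy.lt_or_gt with h'' | h''
      · have t1 := sum_log_lt_of_between h h' s1 l1
        have t2 := sum_log_lt_of_between h' h'' s2 l2
        linarith
      · exact mul_pos_of_neg_of_neg (mul_neg_of_neg_of_pos (by linarith) (by linarith))
          (mul_neg_of_neg_of_pos (by linarith) (by linarith))
  · rcases hpy.lt_or_gt with h' | h'
    · rcases hqy.lt_or_gt with h'' | h''
      · exact mul_pos_of_neg_of_neg (mul_neg_of_pos_of_neg (by linarith) (by linarith))
          (mul_neg_of_neg_of_pos (by linarith) (by linarith))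
      · have t1 := sum_log_lt_of_between h h' s2 l2
        have t2 := sum_log_lt_of_between h' h'' s1 l1
        linarith
    · exact mul_pos (mul_pos (by linarith) (by linarith)) (mul_pos (by linarith) (by linarith))

theorem cross_pos [Nonempty ι] {α : ι → ℝ} {p q x y : ℝ} (hpq : p ≠ q) (hxy : x ≠ y)
    (s1 : ∀ j, 0 < (p - α j) * (q - α j)) (s2 : ∀ j, 0 < (x - α j) * (y - α j))
    (l1 : ∑ j, Real.log (p - α j) = ∑ j, Real.log (q - α j))
    (l2 : ∑ j, Real.log (x - α j) = ∑ j, Real.log (y - α j))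
    (hpx : p ≠ x) (hqy : q ≠ y) (hpy : p ≠ y) (hqx : q ≠ x) :
    0 < (p - x) * (q - y) * ((p - y) * (q - x)) := by
  have s1' (j : ι) : 0 < (q - α j) * (p - α j) := mul_comm (p - α j) (q - α j) ▸ s1 j
  have s2' (j : ι) : 0 < (y - α j) * (x - α j) := mul_comm (x - α j) (y - α j) ▸ s2 j
  rcases hpq.lt_or_gt with h | h <;> rcases hxy.lt_or_gt with h' | h'
  · exact cross_pos_of_lt h h' s1 s2 l1 l2 hpx hqy hpy hqx
  · have := cross_pos_of_lt h h' s1 s2' l1 l2.symm hpy hqx hpx hqy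
    linarith
  · have := cross_pos_of_lt h h' s1' s2 l1.symm l2 hqx hpy hqy hpx
    linarith
  · have := cross_pos_of_lt h h' s1' s2' l1.symm l2.symm hqy hpx hqx hpy
    linarith

/-- A level set of `∑ log |x - α_j|` has no three points in one component. -/
theorem eq_of_sum_log_eq [Nonempty ι] {α : ι → ℝ} {p q x : ℝ} (hpq : p ≠ q) (hxq : x ≠ q)
    (s1 : ∀ j, 0 < (p - α j) * (q - α j)) (s2 : ∀ j, 0 < (x - α j) * (q - α j))
    (l1 : ∑ j, Real.log (p - α j) = ∑ j, Real.log (q - α j))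
    (l2 : ∑ j, Real.log (x - α j) = ∑ j, Real.log (q - α j)) : p = x := by
  have comm {a b : ℝ} (h : ∀ j, 0 < (a - α j) * (b - α j)) (j : ι) :
      0 < (b - α j) * (a - α j) := mul_comm (a - α j) (b - α j) ▸ h j
  have s3 (j : ι) : 0 < (p - α j) * (x - α j) := by
    have := mul_pos (s1 j) (s2 j)
    have hq : 0 < (q - α j) * (q - α j) := by
      have : q - α j ≠ 0 := fun e => by simpa [e] using s1 j
      exact mul_self_pos.2 this
    exact pos_of_mul_pos_left (b := (q - α j) * (q - α j)) (by linarith) hq.le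
  have l3 := l1.trans l2.symm
  have no {a b c : ℝ} (hab : a < b) (hbc : b < c) (s : ∀ j, 0 < (a - α j) * (c - α j))
      (l : ∑ j, Real.log (a - α j) = ∑ j, Real.log (c - α j))
      (l' : ∑ j, Real.log (a - α j) = ∑ j, Real.log (b - α j)) : False :=
    (sum_log_lt_of_between hab hbc s l).ne l'
  by_contra hpx
  rcases lt_or_gt_of_ne hpq with h1 | h1 <;> rcases lt_or_gt_of_ne hxq with h2 | h2 <;>
    rcases lt_or_gt_of_ne hpx with h3 | h3
  · exact no h3 h2 s1 l1 l3
  · exact no h3 h1 s2 l2 l3.symm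
  · exact no h1 h2 s3 l3 l1
  · linarith
  · linarith
  · exact no h2 h1 (comm s3) l3.symm l2
  · exact no h1 h3 (comm s2) l2.symm l1.symm
  · exact no h2 h3 (comm s1) l1.symm l2.symm

/-- If `μ` increases with `α`, the potentials `∑ μ_j log |x - α_j|` and `∑ log |x - α_j|` do not
take equal values at the same two points of one component. -/
theorem sum_mul_log_ne_of_lt {α : ι → ℝ} {μ : ι → ℤ} (hμ : ∀ x y, μ x < μ y → α x < α y)
    (hne : ∃ x y, μ x < μ y) {b c : ℝ} (hbc : b < c) (hs : ∀ j, 0 < (b - α j) * (c - α j))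
    (h : ∑ j, (Real.log (b - α j) - Real.log (c - α j)) = 0) :
    ∑ j, μ j * (Real.log (b - α j) - Real.log (c - α j)) ≠ 0 := by
  obtain ⟨x₀, y₀, hxy⟩ := hne
  have : Nonempty ι := ⟨x₀⟩
  have sgn (j : ι) : (α j < b ∧ Real.log (b - α j) - Real.log (c - α j) < 0) ∨
      (c < α j ∧ 0 < Real.log (b - α j) - Real.log (c - α j)) := by
    rcases pos_and_pos_or_neg_and_neg_of_mul_pos (hs j) with ⟨h1, h2⟩ | ⟨h1, h2⟩
    · exact .inl ⟨by linarith, sub_neg.2 (Real.log_lt_log h1 (by linarith))⟩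
    · refine .inr ⟨by linarith, sub_pos.2 ?_⟩
      rw [← Real.log_neg_eq_log (b - α j), ← Real.log_neg_eq_log (c - α j)]
      exact Real.log_lt_log (by linarith) (by linarith)
  -- `l` separates the values of `μ` at the points below and above the component
  obtain ⟨l, hl⟩ : ∃ l : ℤ, ∀ j, (α j < b → μ j ≤ l) ∧ (c < α j → l ≤ μ j) := by
    by_cases hex : (Finset.univ.filter fun j => α j < b).Nonempty
    · obtain ⟨j₀, hj₀, hmax⟩ := Finset.exists_max_image _ μ hex
      have hj₀ : α j₀ < b := (Finset.mem_filter.1 hj₀).2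
      refine ⟨μ j₀, fun j => ⟨fun hj => hmax j (by simpa using hj), fun hj => ?_⟩⟩
      by_contra hlt
      have := hμ _ _ (not_le.1 hlt)
      linarith
    · obtain ⟨j₀, -, hmin⟩ := Finset.exists_min_image Finset.univ μ Finset.univ_nonempty
      refine ⟨μ j₀, fun j => ⟨fun hj => absurd ⟨j, by simpa using hj⟩ hex,
        fun _ => hmin j (Finset.mem_univ j)⟩⟩
  intro h0
  have hsum : ∑ j, ((μ j : ℝ) - l) * (Real.log (b - α j) - Real.log (c - α j)) = 0 := by
    simp only [sub_mul (_ : ℝ) (l : ℝ), Finset.sum_sub_distrib (f := fun j => (μ j : ℝ) * _)]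
    rw [h0, ← Finset.mul_sum, h]
    simp
  have hnonneg : ∀ j ∈ Finset.univ,
      0 ≤ ((μ j : ℝ) - l) * (Real.log (b - α j) - Real.log (c - α j)) := by
    intro j _
    rcases sgn j with ⟨h1, h2⟩ | ⟨h1, h2⟩
    · have : (μ j : ℝ) ≤ l := by exact_mod_cast (hl j).1 h1
      exact mul_nonneg_of_nonpos_of_nonpos (by linarith) h2.le
    · have : (l : ℝ) ≤ μ j := by exact_mod_cast (hl j).2 h1
      exact mul_nonneg (by linarith) h2.le
  have heq (j : ι) : μ j = l := by
    have := (Finset.sum_eq_zero_iff_of_nonneg hnonneg).1 hsum j (Finset.mem_univ j)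
    rcases mul_eq_zero.1 this with h1 | h1
    · exact_mod_cast sub_eq_zero.1 h1
    · rcases sgn j with ⟨_, h2⟩ | ⟨_, h2⟩ <;> linarith
  rw [heq x₀, heq y₀] at hxy
  exact lt_irrefl _ hxy

theorem sum_mul_log_ne {α : ι → ℝ} {μ : ι → ℤ} (hμ : ∀ x y, μ x < μ y → α x < α y)
    (hne : ∃ x y, μ x < μ y) {b c : ℝ} (hbc : b ≠ c) (hs : ∀ j, 0 < (b - α j) * (c - α j))
    (h : ∑ j, (Real.log (b - α j) - Real.log (c - α j)) = 0) :
    ∑ j, μ j * (Real.log (b - α j) - Real.log (c - α j)) ≠ 0 := by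
  rcases hbc.lt_or_gt with hlt | hlt
  · exact sum_mul_log_ne_of_lt hμ hne hlt hs h
  · have flip (f : ι → ℝ) : ∑ j, f j * (Real.log (c - α j) - Real.log (b - α j)) =
        -∑ j, f j * (Real.log (b - α j) - Real.log (c - α j)) := by
      rw [← Finset.sum_neg_distrib]
      exact Finset.sum_congr rfl fun _ _ => by ring
    have := sum_mul_log_ne_of_lt hμ hne hlt (fun j => mul_comm (b - α j) (c - α j) ▸ hs j)
      (by simpa [h] using flip fun _ => 1)
    rw [flip fun j => (μ j : ℝ)] at this
    exact neg_ne_zero.1 this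

end LogPotential

/-! ### Positivity and growth factors -/

section Regular

variable {n : ℕ} {N : ℕ} {α : ZMod n → ℝ} {b c : Fin N → ℝ}

theorem RegularPairs.sub_mul_sub_pos (h : RegularPairs α b c) (i : Fin N) (j : ZMod n) :
    0 < (b i - α j) * (c i - α j) := by
  have := h.ratio_pos i j
  rcases div_pos_iff.1 this with ⟨h1, h2⟩ | ⟨h1, h2⟩
  · exact mul_pos h1 h2
  · exact mul_pos_of_neg_of_neg h1 h2

variable [Fact (3 ≤ n)]

theorem RegularPairs.sum_log_eq (h : RegularPairs α b c) (h' : CylindricPairs α b c)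
    (i : Fin N) : ∑ j, Real.log (b i - α j) = ∑ j, Real.log (c i - α j) := by
  rw [← Real.log_prod fun j _ => sub_ne_zero.2 (h.b_ne i j),
    ← Real.log_prod fun j _ => sub_ne_zero.2 (h.c_ne i j), h' i]

theorem RegularPairs.solitonZ_pos (h : RegularPairs α b c) (h' : CylindricPairs α b c)
    {i j : Fin N} (hij : i ≠ j) : 0 < solitonZ b c i j := by
  have hc : c i ≠ c j := by
    intro e
    refine h.distinct i j hij (eq_of_sum_log_eq (α := α) (h.nontrivial i)
      (e ▸ h.nontrivial j) (h.sub_mul_sub_pos i) (fun k => e ▸ h.sub_mul_sub_pos j k)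
      (h.sum_log_eq h' i) ?_)
    rw [e]
    exact h.sum_log_eq h' j
  have key := cross_pos (α := α) (h.nontrivial i) (h.nontrivial j) (h.sub_mul_sub_pos i)
    (h.sub_mul_sub_pos j)
    (h.sum_log_eq h' i) (h.sum_log_eq h' j) (h.distinct i j hij) hc (h.b_ne_c i j hij)
    (h.b_ne_c j i hij.symm).symm
  rw [solitonZ]
  rcases pos_and_pos_or_neg_and_neg_of_mul_pos key with ⟨h1, h2⟩ | ⟨h1, h2⟩
  · exact div_pos h1 h2
  · exact div_pos_of_neg_of_neg h1 h2

theorem solitonFactor_pos {A : ℝ} {b c : ℝ} (hA : 0 < A)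
    (h : ∀ j, 0 < (b - α j) / (c - α j)) (s : ZMod n → ℤ) : 0 < solitonFactor α A b c s :=
  mul_pos hA (Finset.prod_pos fun j _ => zpow_pos (h j) _)

theorem RegularPairs.prod_solitonZ_pos (h : RegularPairs α b c) (h' : CylindricPairs α b c)
    (T : Finset (Fin N)) :
    0 < ∏ q ∈ (T ×ˢ T).filter (fun q => q.1 < q.2), solitonZ b c q.1 q.2 :=
  Finset.prod_pos fun _ hq => h.solitonZ_pos h' (Finset.mem_filter.1 hq).2.ne

theorem RegularPairs.solitonTau_pos {A : Fin N → ℝ} (hA : ∀ i, 0 < A i)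
    (h : RegularPairs α b c) (h' : CylindricPairs α b c) (s : ZMod n → ℤ) :
    0 < solitonTau α A b c s :=
  Finset.sum_pos (fun T _ => mul_pos (h.prod_solitonZ_pos h' T)
    (Finset.prod_pos fun i _ => solitonFactor_pos (hA i) (h.ratio_pos i) s)) ⟨∅, Finset.mem_univ _⟩

/-- The growth factor of a nontrivial soliton along the state words differs from one. -/
theorem RegularPairs.growth_ne_one (h : RegularPairs α b c) (h' : CylindricPairs α b c)
    {μ : ZMod n → ℤ} (hμ : ∀ x y, μ x < μ y → α x < α y) (hne : ∃ x y, μ x < μ y) (i : Fin N) :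
    ∏ j, ((b i - α j) / (c i - α j)) ^ μ j ≠ 1 := by
  intro e
  refine sum_mul_log_ne hμ hne (h.nontrivial i) (h.sub_mul_sub_pos i)
    (by rw [Finset.sum_sub_distrib, h.sum_log_eq h', sub_self]) ?_
  have := congrArg Real.log e
  rw [Real.log_one, Real.log_prod fun j _ => (zpow_pos (h.ratio_pos i j) _).ne'] at this
  rw [← this]
  refine Finset.sum_congr rfl fun j _ => ?_
  rw [Real.log_zpow, Real.log_div (sub_ne_zero.2 (h.b_ne i j)) (sub_ne_zero.2 (h.c_ne i j))]

end Regular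

/-! ### Asymptotics of the soliton `τ`-function -/

section Asymptotics

variable {N : ℕ}

theorem tendsto_zpow_zero {x : ℝ} (hx : 0 < x) {F : Filter ℤ}
    (h : Tendsto (fun i : ℤ => Real.log x * i) F atBot) : Tendsto (fun i : ℤ => x ^ i) F (𝓝 0) := by
  refine (Real.tendsto_exp_atBot.comp h).congr fun i => ?_
  rw [Function.comp_apply, ← Real.rpow_def_of_pos hx, Real.rpow_intCast]

/-- For each growth factor, either its powers or their inverses vanish in the limit. -/
theorem tendsto_zpow_or {x : ℝ} (hx : 0 < x) (h1 : x ≠ 1) {F : Filter ℤ}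
    (hF : F = atTop ∨ F = atBot) :
    Tendsto (fun i : ℤ => x ^ i) F (𝓝 0) ∨ Tendsto (fun i : ℤ => (x ^ i)⁻¹) F (𝓝 0) := by
  have hinv : ∀ i : ℤ, (x⁻¹) ^ i = (x ^ i)⁻¹ := fun i => inv_zpow x i
  have hl : Real.log x < 0 ∨ 0 < Real.log x :=
    (Real.log_ne_zero_of_pos_of_ne_one hx h1).lt_or_gt
  have top : Tendsto (fun i : ℤ => (i : ℝ)) atTop atTop := tendsto_intCast_atTop_atTop
  have bot : Tendsto (fun i : ℤ => (i : ℝ)) atBot atBot :=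
    tendsto_intCast_atBot_iff.2 tendsto_id
  have key : Tendsto (fun i : ℤ => Real.log x * i) F atBot ∨
      Tendsto (fun i : ℤ => Real.log x⁻¹ * i) F atBot := by
    rw [Real.log_inv]
    rcases hF with rfl | rfl <;> rcases hl with hl | hl
    · exact .inl (top.const_mul_atTop_of_neg hl)
    · exact .inr (top.const_mul_atTop_of_neg (neg_neg_of_pos hl))
    · exact .inr (bot.const_mul_atBot (neg_pos.2 hl))
    · exact .inl (bot.const_mul_atBot hl)
  refine key.imp (tendsto_zpow_zero hx) fun h => ?_
  exact (tendsto_zpow_zero (inv_pos.2 hx) h).congr hinv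

open Classical in
/-- A sum over subsets of products of exponentials is dominated by one of its terms. -/
theorem tendsto_sum_subsets_div {x : Fin N → ℝ} (hx : ∀ k, 0 < x k) {F : Filter ℤ}
    {D : Finset (Fin N)}
    (h1 : ∀ k ∉ D, Tendsto (fun i : ℤ => x k ^ i) F (𝓝 0))
    (h2 : ∀ k ∈ D, Tendsto (fun i : ℤ => (x k ^ i)⁻¹) F (𝓝 0)) (K : Finset (Fin N) → ℝ) :
    Tendsto (fun i : ℤ => (∑ T, K T * ∏ k ∈ T, x k ^ i) / ∏ k ∈ D, x k ^ i) F (𝓝 (K D)) := by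
  have hT : ∀ T : Finset (Fin N), Tendsto (fun i : ℤ => (∏ k ∈ T, x k ^ i) / ∏ k ∈ D, x k ^ i) F
      (𝓝 (if T = D then 1 else 0)) := by
    intro T
    have hk : ∀ k, Tendsto (fun i : ℤ => (if k ∈ T then x k ^ i else 1) /
        (if k ∈ D then x k ^ i else 1)) F (𝓝 (if k ∈ T ↔ k ∈ D then 1 else 0)) := by
      intro k
      by_cases hT : k ∈ T <;> by_cases hD : k ∈ D <;> simp only [hT, hD, if_true, if_false]
      · refine tendsto_const_nhds.congr fun i => ?_
        rw [div_self (zpow_pos (hx k) i).ne']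
      · simpa using h1 k hD
      · simpa using h2 k hD
      · simpa using tendsto_const_nhds
    have := tendsto_finsetProd Finset.univ fun k _ => hk k
    have e : (∏ k : Fin N, (if k ∈ T ↔ k ∈ D then (1 : ℝ) else 0)) = if T = D then 1 else 0 := by
      by_cases h : T = D
      · simp [h]
      · rw [if_neg h]
        obtain ⟨k, hk⟩ := not_forall.1 fun h' => h (Finset.ext h')
        exact Finset.prod_eq_zero (Finset.mem_univ k) (if_neg hk)
    rw [e] at this
    refine this.congr fun i => ?_
    rw [Finset.prod_div_distrib, Finset.prod_ite_mem, Finset.prod_ite_mem, Finset.univ_inter,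
      Finset.univ_inter]
  have := tendsto_finsetSum Finset.univ fun T _ => (hT T).const_mul (K T)
  have e : ∑ T : Finset (Fin N), K T * (if T = D then (1 : ℝ) else 0) = K D := by simp
  rw [e] at this
  refine this.congr fun i => ?_
  rw [Finset.sum_div]
  exact Finset.sum_congr rfl fun T _ => by rw [mul_div_assoc]

variable {n : ℕ} [Fact (3 ≤ n)] {α : ZMod n → ℝ} {b c : Fin N → ℝ}

/-- Along the direction `μ` the four values of the `τ`-function around a crossing become
proportional. -/
theorem RegularPairs.tendsto_ratio {A : Fin N → ℝ} (hA : ∀ i, 0 < A i)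
    (h : RegularPairs α b c) (h' : CylindricPairs α b c) {μ : ZMod n → ℤ}
    (hμ : ∀ x y, μ x < μ y → α x < α y) (hne : ∃ x y, μ x < μ y) {F : Filter ℤ}
    (hF : F = atTop ∨ F = atBot) (s x y : ZMod n → ℤ) :
    Tendsto (fun i : ℤ => solitonTau α A b c (s + i • μ) * solitonTau α A b c (s + x + y + i • μ) /
      (solitonTau α A b c (s + x + i • μ) * solitonTau α A b c (s + y + i • μ))) F (𝓝 1) := by
  classical
  set G : Fin N → ℝ := fun k => ∏ j, ((b k - α j) / (c k - α j)) ^ μ j with hG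
  have hG0 : ∀ k, 0 < G k := fun k => Finset.prod_pos fun j _ => zpow_pos (h.ratio_pos k j) _
  have hlim : ∀ k, Tendsto (fun i : ℤ => G k ^ i) F (𝓝 0) ∨
      Tendsto (fun i : ℤ => (G k ^ i)⁻¹) F (𝓝 0) := fun k =>
    tendsto_zpow_or (hG0 k) (h.growth_ne_one h' hμ hne k) hF
  set D : Finset (Fin N) := Finset.univ.filter fun k => ¬Tendsto (fun i : ℤ => G k ^ i) F (𝓝 0)
    with hD
  set f : (ZMod n → ℤ) → Fin N → ℝ := fun s k => solitonFactor α (A k) (b k) (c k) s with hf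
  have hf0 : ∀ s k, 0 < f s k := fun s k => solitonFactor_pos (hA k) (h.ratio_pos k) s
  set C : Finset (Fin N) → ℝ := fun T =>
    ∏ q ∈ (T ×ˢ T).filter (fun q => q.1 < q.2), solitonZ b c q.1 q.2 with hC
  have hτ : ∀ s, ∀ i : ℤ, solitonTau α A b c (s + i • μ) =
      ∑ T, (C T * ∏ k ∈ T, f s k) * ∏ k ∈ T, G k ^ i := by
    intro s i
    rw [solitonTau]
    refine Finset.sum_congr rfl fun T _ => ?_
    rw [mul_assoc, ← Finset.prod_mul_distrib]
    congr 1
    refine Finset.prod_congr rfl fun k _ => ?_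
    rw [solitonFactor_add (h.b_ne k) (h.c_ne k), hf, hG]
    congr 1
    dsimp only
    rw [← Finset.prod_zpow]
    refine Finset.prod_congr rfl fun j _ => ?_
    rw [Pi.smul_apply, smul_eq_mul, mul_comm, zpow_mul]
  have lim := fun s => tendsto_sum_subsets_div hG0 (F := F) (D := D)
    (fun k hk => by simpa [hD] using hk)
    (fun k hk => (hlim k).resolve_left (by simpa [hD] using hk)) fun T => C T * ∏ k ∈ T, f s k
  have hK : ∀ s, C D * ∏ k ∈ D, f s k ≠ 0 := fun s =>
    (mul_pos (h.prod_solitonZ_pos h' D) (Finset.prod_pos fun k _ => hf0 s k)).ne'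
  have main := ((lim s).mul (lim (s + x + y))).div ((lim (s + x)).mul (lim (s + y)))
    (mul_ne_zero (hK _) (hK _))
  have e : C D * (∏ k ∈ D, f s k) * (C D * ∏ k ∈ D, f (s + x + y) k) /
      (C D * (∏ k ∈ D, f (s + x) k) * (C D * ∏ k ∈ D, f (s + y) k)) = 1 := by
    have e' : (∏ k ∈ D, f s k) * ∏ k ∈ D, f (s + x + y) k =
        (∏ k ∈ D, f (s + x) k) * ∏ k ∈ D, f (s + y) k := by
      rw [← Finset.prod_mul_distrib, ← Finset.prod_mul_distrib]
      refine Finset.prod_congr rfl fun k _ => ?_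
      simp only [hf, solitonFactor_add (h.b_ne k) (h.c_ne k)]
      ring
    rw [div_eq_one_iff_eq (mul_ne_zero (hK _) (hK _))]
    linear_combination C D * C D * e'
  rw [e] at main
  refine main.congr fun i => ?_
  have hDi : ∏ k ∈ D, G k ^ i ≠ 0 := (Finset.prod_pos fun k _ => zpow_pos (hG0 k) i).ne'
  rw [hτ, hτ, hτ, hτ]
  simp only [Pi.div_apply]
  rw [div_mul_div_comm, div_mul_div_comm, div_div_div_cancel_right₀ (mul_ne_zero hDi hDi)]

end Asymptotics

/-! ### Existence of solitons -/

section Existence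

variable {n : ℕ} [Fact (3 ≤ n)]

/-- Between two consecutive weights the polynomial `∏ (x - α_j)` takes each value between zero and
its value at the midpoint on both sides of the midpoint, which gives the pairs `b_i`, `c_i`. -/
theorem exists_regularPairs {α : ZMod n → ℝ} (hα : ∃ x y, α x < α y) (N : ℕ) :
    ∃ b c : Fin N → ℝ, RegularPairs α b c ∧ CylindricPairs α b c := by
  obtain ⟨x₀, y₀, hxy⟩ := hα
  obtain ⟨y₁, hy₁, hmin⟩ := Finset.exists_min_image (Finset.univ.filter fun j => α x₀ < α j) α
    ⟨y₀, by simpa using hxy⟩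
  have hlt : α x₀ < α y₁ := (Finset.mem_filter.1 hy₁).2
  have gap : ∀ j, α j ≤ α x₀ ∨ α y₁ ≤ α j := fun j => by
    by_cases hj : α x₀ < α j
    · exact .inr (hmin j (by simpa using hj))
    · exact .inl (not_lt.1 hj)
  set Q : ℝ → ℝ := fun x => ∏ j, (x - α j) with hQ
  have hcont : Continuous Q := by fun_prop
  have hQx : Q (α x₀) = 0 := Finset.prod_eq_zero (Finset.mem_univ x₀) (sub_self _)
  have hQy : Q (α y₁) = 0 := Finset.prod_eq_zero (Finset.mem_univ y₁) (sub_self _)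
  set m : ℝ := (α x₀ + α y₁) / 2 with hm
  have hm1 : α x₀ < m := by rw [hm]; linarith
  have hm2 : m < α y₁ := by rw [hm]; linarith
  have ne_of_mem {x : ℝ} (h1 : α x₀ < x) (h2 : x < α y₁) (j : ZMod n) : x ≠ α j := by
    rintro rfl
    rcases gap j with h | h <;> linarith
  have hQm : Q m ≠ 0 := Finset.prod_ne_zero_iff.2 fun j _ => sub_ne_zero.2 (ne_of_mem hm1 hm2 j)
  -- the levels `θ_i Q m` are distinct and lie strictly between `0` and `Q m`
  set θ : Fin N → ℝ := fun i => ((i : ℕ) + 1) / (N + 1) with hθ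
  have hθ0 (i : Fin N) : 0 < θ i := by positivity
  have hθ1 (i : Fin N) : θ i < 1 := by
    rw [hθ, div_lt_one (by positivity)]
    have : ((i : ℕ) : ℝ) < N := by exact_mod_cast i.2
    linarith
  have level (i : Fin N) (x : ℝ) (hx : Q x = θ i * Q m) : x ≠ α x₀ ∧ x ≠ m ∧ x ≠ α y₁ := by
    have h0 : θ i * Q m ≠ 0 := mul_ne_zero (hθ0 i).ne' hQm
    refine ⟨?_, ?_, ?_⟩ <;> rintro rfl
    · exact h0 (hx.symm.trans hQx)
    · exact (hθ1 i).ne (mul_right_cancel₀ hQm (by rw [one_mul]; exact hx.symm))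
    · exact h0 (hx.symm.trans hQy)
  have mem (i : Fin N) : θ i * Q m ∈ Set.uIcc 0 (Q m) := by
    rcases hQm.lt_or_gt with h | h
    · rw [Set.uIcc_of_ge h.le]
      exact ⟨by nlinarith [hθ1 i], by nlinarith [hθ0 i]⟩
    · rw [Set.uIcc_of_le h.le]
      exact ⟨by nlinarith [hθ0 i], by nlinarith [hθ1 i]⟩
  have hb (i : Fin N) : ∃ x, α x₀ < x ∧ x < m ∧ Q x = θ i * Q m := by
    obtain ⟨x, hx, e⟩ := intermediate_value_uIcc (a := α x₀) (b := m) hcont.continuousOn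
      (by rw [hQx]; exact mem i)
    rw [Set.uIcc_of_le hm1.le] at hx
    obtain ⟨l1, l2, l3⟩ := level i x e
    exact ⟨x, lt_of_le_of_ne hx.1 l1.symm, lt_of_le_of_ne hx.2 l2, e⟩
  have hc (i : Fin N) : ∃ x, m < x ∧ x < α y₁ ∧ Q x = θ i * Q m := by
    obtain ⟨x, hx, e⟩ := intermediate_value_uIcc (a := α y₁) (b := m) hcont.continuousOn
      (by rw [hQy]; exact mem i)
    rw [Set.uIcc_of_ge hm2.le] at hx
    obtain ⟨l1, l2, l3⟩ := level i x e
    exact ⟨x, lt_of_le_of_ne hx.1 l2.symm, lt_of_le_of_ne hx.2 l3, e⟩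
  choose b hb1 hb2 hb3 using hb
  choose c hc1 hc2 hc3 using hc
  refine ⟨b, c, ⟨⟨fun i => ne_of_mem (hb1 i) ((hb2 i).trans hm2),
    fun i => ne_of_mem (hm1.trans (hc1 i)) (hc2 i), fun i j _ => ((hb2 i).trans (hc1 j)).ne⟩,
    fun i j => ?_, fun i => ((hb2 i).trans (hc1 i)).ne, fun i j hij e => hij ?_⟩,
    fun i => (hb3 i).trans (hc3 i).symm⟩
  · have h1 := hb1 i
    have h2 := hb2 i
    have h3 := hc1 i
    have h4 := hc2 i
    rcases gap j with h | h
    · exact div_pos (by linarith) (by linarith)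
    · exact div_pos_of_neg_of_neg (by linarith) (by linarith)
  · have h1 : θ i * Q m = θ j * Q m := by rw [← hb3, ← hb3, e]
    have h2 := mul_right_cancel₀ hQm h1
    simp only [hθ] at h2
    rw [div_left_inj' (by positivity)] at h2
    exact Fin.ext (by exact_mod_cast add_right_cancel h2)

end Existence

theorem theorem1p2 (n : ℕ) [Fact (3 ≤ n)] (P : AffineDKdV n) (hu : P.u ≠ []) :
    -- the vacuum and the initial carrier are positive and unchanged by the interaction
    ((∀ p, 0 < P.vacuum p) ∧ (∀ p, 0 < P.initialCarrier p) ∧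
      Interacts P.u P.v P.initialCarrier P.vacuum P.vacuum P.initialCarrier) ∧
    -- the soliton `τ`-functions are BHZ data, cylindric for cylindric pairs
    (∀ (N : ℕ) (A b c : Fin N → ℝ), AdmissiblePairs P.α b c →
      IsBHZ P.α (solitonTau P.α A b c) ∧
      (CylindricPairs P.α b c → IsCylindricBHZ P.α (solitonTau P.α A b c))) ∧
    -- the ratios at the crossings solve affine dKdV
    (∃ W : ℤ → ℤ → Equiv.Perm ℤ, P.IsWiring W ∧
      ∀ (N : ℕ) (A b c : Fin N → ℝ), (∀ i, 0 < A i) → RegularPairs P.α b c →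
        CylindricPairs P.α b c →
        (∀ s, 0 < solitonTau P.α A b c s) ∧
        P.IsSolution (P.tauState W (solitonTau P.α A b c))
          (P.tauCarrier W (solitonTau P.α A b c))) ∧
    -- such data exist for every number of solitons
    (∀ N : ℕ, ∃ b c : Fin N → ℝ, RegularPairs P.α b c ∧ CylindricPairs P.α b c) := by
  refine ⟨⟨fun p => sub_pos.2 (P.weights_lt_state p), fun p => sub_pos.2 (P.weights_lt_carrier p),
    P.interacts_vacuum⟩, fun N A b c h => ⟨isBHZ_solitonTau h, isCylindricBHZ_solitonTau h⟩,
    ⟨P.wiring, P.isWiring_wiring, fun N A b c hA h h' => ⟨h.solitonTau_pos hA h', ?_⟩⟩,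
    exists_regularPairs (P.exists_α_lt hu)⟩
  exact P.isSolution_of_tau (isCylindricBHZ_solitonTau h.toAdmissiblePairs h')
    (h.solitonTau_pos hA h') fun F hF s x y => h.tendsto_ratio hA h'
      (fun _ _ => P.α_lt_of_stateVec_lt) (P.exists_stateVec_lt hu) hF s x y
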